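/- Let $\Bbbk$ be a field. For a finite set $I$, a (nonempty) polyhedron $\mathfrak p\subset\mathbb R^I$ and $x\in\mathbb R^I$ let $\mathfrak p_x$ be the face of $\mathfrak p$ on which $y\mapsto x\cdot y$ is maximal (empty if the functional is unbounded above on $\mathfrak p$). The normal fan $\mathcal N(\mathfrak p)$ consists of the cones $\{x:\mathfrak p_x=\mathfrak q\}$, for the nonempty faces $\mathfrak q=\mathfrak p_{x_0}$ of $\mathfrak p$. The braid fan in $\mathbb R^I$ consists of the relatively open faces of the arrangement of the hyperplanes $x_i=x_j$. An \emph{extended generalized permutahedron} in $\mathbb R^I$ is a nonempty polyhedron whose normal fan coarsens a convex subfan of the braid fan. Let $\mathbf L^*$ be the Hopf monoid of linear orders: $\mathbf L^*[I]$ has the linear orders on $I$ as a basis, the product of $w$ and $u$ is the sum of all shuffles of $w$ and $u$, and $\Delta_{I,J}(v)=v|_I\otimes v|_J$ if $v|_I$ is an initial segment of $v$, and $0$ otherwise. Let $\mathbf{GP}_+$ be the Hopf monoid of extended generalized permutahedra: $\mathbf{GP}_+[I]$ has the extended generalized permutahedra in $\mathbb R^I$ as a basis, the product is $\mathfrak p_1\times\mathfrak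 p_2$, and for $\mathfrak p\subset\mathbb R^{I\sqcup J}$ one has $\Delta_{I,J}(\mathfrak p)=\mathfrak p|I\otimes\mathfrak p/I$ if $\mathfrak p$ is bounded above in the direction of the indicator vector $1_I$, where $\mathfrak p_{1_I}=\mathfrak p|I\times\mathfrak p/I$ with $\mathfrak p|I\subset\mathbb R^I$ and $\mathfrak p/I\subset\mathbb R^J$, and $\Delta_{I,J}(\mathfrak p)=0$ otherwise. In both cases the unit is the unique basis element over $\emptyset$, and the counit sends it to $1$. Let $\mathbf L^*\times\mathbf{GP}_+$ be the Hadamard product, $(\mathbf L^*\times\mathbf{GP}_+)[I]=\mathbf L^*[I]\otimes\mathbf{GP}_+[I]$ with componentwise operations. For a linear order $w$ on $I$ let $\sigma_w\subset\mathbb R^I$ be its braid chamber, the open cone of all $x$ whose coordinates strictly increase along $w$ ($x_i<x_j$ if and only if $i$ precedes $j$ in $w$). Let $\mathbf{OGP}_+[I]\subseteq(\mathbf L^*\times\mathbf{GP}_+)[I]$ be the subspace spanned by the tensors $w\otimes\mathfrak p$ such that $\sigma_w$ is contained in (the union of the cones of) $\mathcal N(\mathfrak p)$. \textbf{Theorem.}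 $\mathbf L^*\times\mathbf{GP}_+$ is a connected Hopf monoid in vector species, and $\mathbf{OGP}_+$ is a Hopf submonoid of it: it is closed under relabelling, contains the unit, and satisfies $\mathbf{OGP}_+[I]\cdot\mathbf{OGP}_+[J]\subseteq\mathbf{OGP}_+[I\sqcup J]$ and $\Delta_{I,J}(\mathbf{OGP}_+[I\sqcup J])\subseteq\mathbf{OGP}_+[I]\otimes\mathbf{OGP}_+[J]$ for all finite sets $I,J$. Moreover, if $\sigma_w$ is contained in $\mathcal N(\mathfrak p)$, then the set $\mathfrak p_w$ of the points of $\mathfrak p$ that maximize all functionals $y\mapsto x\cdot y$ with $x\in\sigma_w$ consists of a single point, which is a vertex of $\mathfrak p$. The same statements hold if instead $\sigma_w$ is taken to be the opposite chamber, consisting of all $x$ whose coordinates strictly decrease along $w$. -/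

import Mathlib

open scoped TensorProduct

universe u v w

noncomputable section

namespace OrderedGP

/-! ### Polyhedra, faces and normal fans in `ℝ^I` -/

/-- The standard inner product on `ℝ^I`, for a finite set `I`. -/
def dot {I : Type u} (x y : I → ℝ) : ℝ := ∑ᶠ i, x i * y i

/-- An intersection of finitely many closed half-spaces. -/
def IsPolyhedron {I : Type u} (p : Set (I → ℝ)) : Prop :=
  ∃ (m : ℕ) (a : Fin m → I → ℝ) (b : Fin m → ℝ), p = {y | ∀ i, dot (a i) y ≤ b i}

/-- The face of `p` on which the linear functional `dot x` is maximal; it is empty if the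
functional is unbounded above on `p`. -/
def face {I : Type u} (p : Set (I → ℝ)) (x : I → ℝ) : Set (I → ℝ) :=
  {y | y ∈ p ∧ ∀ z ∈ p, dot x z ≤ dot x y}

/-- The (relatively open) normal cone of `q` in `p`. -/
def normalCone {I : Type u} (p q : Set (I → ℝ)) : Set (I → ℝ) := {x | face p x = q}

/-- The normal fan of `p`: the set of the normal cones of the nonempty faces of `p`. -/
def normalFan {I : Type u} (p : Set (I → ℝ)) : Set (Set (I → ℝ)) :=
  {N | ∃ x : I → ℝ, (face p x).Nonempty ∧ N = normalCone p (face p x)}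

/-! ### The braid fan and extended generalized permutahedra -/

/-- The relatively open face of the braid arrangement that contains `x`. -/
def braidFace {I : Type u} (x : I → ℝ) : Set (I → ℝ) :=
  {y | ∀ i j, y i < y j ↔ x i < x j}

/-- The braid fan: all relatively open faces of the braid arrangement in `ℝ^I`. -/
def braidFan (I : Type u) : Set (Set (I → ℝ)) := {σ | ∃ x : I → ℝ, σ = braidFace x}

/-- A convex subfan of the braid fan: a set of faces of the braid fan that is closed under passing
to faces and whose union is convex. -/
structure IsConvexBraidSubfan {I : Type u} (F : Set (Set (I → ℝ))) : Prop where
  subset : F ⊆ braidFan I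
  faces : ∀ σ ∈ F, ∀ τ ∈ braidFan I, τ ⊆ closure σ → τ ∈ F
  convex : Convex ℝ (⋃₀ F)

/-- The fan `N` coarsens the fan `F`: they have the same support, and every cone of `F` lies in
a cone of `N`. -/
def Coarsens {I : Type u} (N F : Set (Set (I → ℝ))) : Prop :=
  ⋃₀ N = ⋃₀ F ∧ ∀ σ ∈ F, ∃ τ ∈ N, σ ⊆ τ

/-- An extended generalized permutahedron: a nonempty polyhedron whose normal fan coarsens a
convex subfan of the braid fan. -/
def IsEGP {I : Type u} (p : Set (I → ℝ)) : Prop :=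
  IsPolyhedron p ∧ p.Nonempty ∧
    ∃ F : Set (Set (I → ℝ)), IsConvexBraidSubfan F ∧ Coarsens (normalFan p) F

/-! ### Auxiliary facts on polyhedra -/

lemma dot_comm {I : Type u} (x y : I → ℝ) : dot x y = dot y x := by
  simp only [dot, mul_comm]

lemma dot_add {I : Type u} [Finite I] (x y z : I → ℝ) : dot x (y + z) = dot x y + dot x z := by
  cases nonempty_fintype I
  simp [dot, finsum_eq_sum_of_fintype, mul_add, Finset.sum_add_distrib]

lemma dot_smul {I : Type u} [Finite I] (x : I → ℝ) (c : ℝ) (y : I → ℝ) :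
    dot x (c • y) = c * dot x y := by
  cases nonempty_fintype I
  simp [dot, finsum_eq_sum_of_fintype, Finset.mul_sum, mul_left_comm]

lemma add_dot {I : Type u} [Finite I] (x y z : I → ℝ) : dot (x + y) z = dot x z + dot y z := by
  rw [dot_comm, dot_add, dot_comm z, dot_comm z]

lemma smul_dot {I : Type u} [Finite I] (c : ℝ) (x y : I → ℝ) : dot (c • x) y = c * dot x y := by
  rw [dot_comm, dot_smul, dot_comm]

lemma zero_dot {I : Type u} (x : I → ℝ) : dot 0 x = 0 := by simp [dot]

lemma continuous_dot {I : Type u} [Finite I] (y : I → ℝ) : Continuous fun x : I → ℝ => dot x y := by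
  cases nonempty_fintype I
  simp only [dot, finsum_eq_sum_of_fintype]
  fun_prop

/-- The linear form `dot x`. -/
def dotLin {I : Type u} [Finite I] (x : I → ℝ) : (I → ℝ) →ₗ[ℝ] ℝ where
  toFun := dot x
  map_add' := dot_add x
  map_smul' c y := dot_smul x c y

/-- Farkas' lemma. -/
lemma farkas {W : Type*} [AddCommGroup W] [Module ℝ W] (m : ℕ) :
    ∀ (A : Fin m → W →ₗ[ℝ] ℝ) (B : W →ₗ[ℝ] ℝ),
      (∀ x, (∀ i, A i x ≤ 0) → B x ≤ 0) →
      ∃ l : Fin m → ℝ, (∀ i, 0 ≤ l i) ∧ ∀ x, B x = ∑ i, l i * A i x := by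
  induction m with
  | zero =>
    intro A B h
    refine ⟨0, by simp, fun x => ?_⟩
    have h1 := h x (fun i => i.elim0)
    have h2 := h (-x) (fun i => i.elim0)
    simp only [map_neg] at h2
    simp
    linarith
  | succ m ih =>
    intro A B h
    by_cases hc : ∀ x, (∀ i : Fin m, A i.succ x ≤ 0) → B x ≤ 0
    · obtain ⟨l, hl, hB⟩ := ih (fun i => A i.succ) B hc
      refine ⟨Fin.cons 0 l, fun i => ?_, fun x => ?_⟩
      · refine Fin.cases ?_ (fun j => ?_) i
        · simp
        · simpa using hl j
      · simp [Fin.sum_univ_succ, hB x]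
    · push Not at hc
      obtain ⟨x0, hx0, hB0⟩ := hc
      have hA0 : 0 < A 0 x0 := by
        by_contra hn
        push Not at hn
        exact absurd (h x0 (fun i => Fin.cases hn hx0 i)) (not_le.mpr hB0)
      set t := A 0 x0 with ht
      obtain ⟨l, hl, hB⟩ := ih (fun i => A i.succ - (A i.succ x0 / t) • A 0)
        (B - (B x0 / t) • A 0) (by
          intro x hx
          have hz := h (x - (A 0 x / t) • x0) (fun i => by
            refine Fin.cases ?_ (fun j => ?_) i
            · simp only [map_sub, map_smul, smul_eq_mul, ← ht]
              rw [div_mul_cancel₀ _ hA0.ne']; simp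
            · have := hx j
              simp only [map_sub, map_smul, smul_eq_mul, LinearMap.sub_apply,
                LinearMap.smul_apply] at this ⊢
              calc _ = A j.succ x - A j.succ x0 / t * A 0 x := by ring
                _ ≤ 0 := this)
          simp only [map_sub, map_smul, smul_eq_mul, LinearMap.sub_apply,
                LinearMap.smul_apply] at hz ⊢
          calc _ = B x - A 0 x / t * B x0 := by ring
            _ ≤ 0 := hz)
      refine ⟨Fin.cons (B x0 / t - ∑ i, l i * (A i.succ x0 / t)) l, fun i => ?_, fun x => ?_⟩
      · refine Fin.cases ?_ (fun j => ?_) i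
        · simp only [Fin.cons_zero]
          have : ∑ i, l i * (A i.succ x0 / t) ≤ 0 := Finset.sum_nonpos fun i _ =>
            mul_nonpos_of_nonneg_of_nonpos (hl i) (div_nonpos_of_nonpos_of_nonneg (hx0 i) hA0.le)
          have := div_pos hB0 hA0
          linarith
        · simpa using hl j
      · have := hB x
        simp only [LinearMap.sub_apply, LinearMap.smul_apply, smul_eq_mul, mul_sub,
          Finset.sum_sub_distrib] at this
        simp only [Fin.sum_univ_succ, Fin.cons_zero, Fin.cons_succ, sub_mul, Finset.sum_mul]
        simp only [← mul_assoc] at this ⊢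
        linarith

lemma farkas_infeasible {I : Type u} [Finite I] {m : ℕ} (a : Fin m → I → ℝ) (b : Fin m → ℝ)
    (h : ∀ y, ¬ ∀ i, dot (a i) y ≤ b i) :
    ∃ l : Fin m → ℝ, (∀ i, 0 ≤ l i) ∧ (∀ y, ∑ i, l i * dot (a i) y = 0) ∧
      ∑ i, l i * b i < 0 := by
  obtain ⟨l, hl, hB⟩ := farkas m
    (fun i => dotLin (a i) ∘ₗ LinearMap.fst ℝ (I → ℝ) ℝ - b i • LinearMap.snd ℝ (I → ℝ) ℝ)
    (LinearMap.snd ℝ (I → ℝ) ℝ) (by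
      rintro ⟨y, t⟩ hy
      by_contra ht
      simp only [LinearMap.snd_apply, not_le] at ht
      refine h (t⁻¹ • y) fun i => ?_
      have := hy i
      simp only [dotLin, LinearMap.sub_apply, LinearMap.comp_apply, LinearMap.fst_apply,
        LinearMap.smul_apply, LinearMap.snd_apply, smul_eq_mul, LinearMap.coe_mk,
        AddHom.coe_mk] at this
      rw [dot_smul, inv_mul_le_iff₀ ht]
      linarith)
  refine ⟨l, hl, fun y => ?_, ?_⟩
  · have := hB (y, 0)
    simpa [dotLin] using this.symm
  · have := hB (0, 1)
    have h0 : ∀ i, dot (a i) (0 : I → ℝ) = 0 := fun i => by rw [dot_comm, zero_dot]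
    simp [dotLin, h0] at this
    linarith

/-- Affine form of Farkas' lemma. -/
lemma farkas_affine {I : Type u} [Finite I] {m : ℕ} (a : Fin m → I → ℝ) (b : Fin m → ℝ)
    (hne : ∃ y, ∀ i, dot (a i) y ≤ b i) (c : I → ℝ) (M : ℝ)
    (h : ∀ y, (∀ i, dot (a i) y ≤ b i) → dot c y ≤ M) :
    ∃ l : Fin m → ℝ, (∀ i, 0 ≤ l i) ∧ (∀ y, dot c y = ∑ i, l i * dot (a i) y) ∧
      ∑ i, l i * b i ≤ M := by
  obtain ⟨y0, hy0⟩ := hne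
  obtain ⟨l, hl, hB⟩ := farkas (m + 1)
    (Fin.cons (-LinearMap.snd ℝ (I → ℝ) ℝ) (fun i =>
      dotLin (a i) ∘ₗ LinearMap.fst ℝ (I → ℝ) ℝ - b i • LinearMap.snd ℝ (I → ℝ) ℝ))
    (dotLin c ∘ₗ LinearMap.fst ℝ (I → ℝ) ℝ - M • LinearMap.snd ℝ (I → ℝ) ℝ) (by
      rintro ⟨y, t⟩ hy
      have ht : 0 ≤ t := by simpa using hy 0
      have hi : ∀ i, dot (a i) y ≤ b i * t := fun i => by
        simpa [dotLin] using hy i.succ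
      suffices dot c y ≤ M * t by simpa [dotLin] using this
      rcases ht.eq_or_lt with rfl | ht
      · simp only [mul_zero] at hi ⊢
        by_contra hn
        push Not at hn
        have := h (y0 + ((M - dot c y0 + 1) / dot c y) • y) (fun i => by
          rw [dot_add, dot_smul]
          have h1 : 0 ≤ (M - dot c y0 + 1) / dot c y := by
            have := h y0 hy0
            apply div_nonneg _ hn.le
            linarith
          nlinarith [hy0 i, hi i, mul_nonpos_of_nonneg_of_nonpos h1 (hi i)])
        rw [dot_add, dot_smul, div_mul_cancel₀ _ hn.ne'] at this
        linarith
      · have := h (t⁻¹ • y) (fun i => by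
          rw [dot_smul, inv_mul_le_iff₀ ht, mul_comm]; exact hi i)
        rw [dot_smul, inv_mul_le_iff₀ ht] at this
        linarith)
  refine ⟨fun i => l i.succ, fun i => hl _, fun y => ?_, ?_⟩
  · have := hB (y, 0)
    simpa [dotLin, Fin.sum_univ_succ] using this
  · have := hB (0, 1)
    have h0 : ∀ x : I → ℝ, dot x (0 : I → ℝ) = 0 := fun i => by rw [dot_comm, zero_dot]
    simp [dotLin, h0, Fin.sum_univ_succ] at this
    have := hl 0
    linarith

lemma IsPolyhedron.inter_halfspace {I : Type u} {p : Set (I → ℝ)} (hp : IsPolyhedron p)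
    (c : I → ℝ) (M : ℝ) : IsPolyhedron {y | y ∈ p ∧ dot c y ≤ M} := by
  obtain ⟨m, a, b, rfl⟩ := hp
  refine ⟨m + 1, Fin.cons c a, Fin.cons M b, ?_⟩
  ext y
  simp [Fin.forall_fin_succ, and_comm]

lemma IsPolyhedron.face {I : Type u} [Finite I] {p : Set (I → ℝ)} (hp : IsPolyhedron p)
    (x : I → ℝ) (h : (face p x).Nonempty) : IsPolyhedron (face p x) := by
  obtain ⟨y, hy, hmax⟩ := h
  convert hp.inter_halfspace ((-1 : ℝ) • x) (-dot x y) using 1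
  ext z
  simp only [OrderedGP.face, Set.mem_ofPred_eq, smul_dot]
  refine and_congr_right fun hz => ⟨fun h => ?_, fun h z' hz' => ?_⟩
  · linarith [h y hy]
  · linarith [hmax z' hz']

lemma face_nonempty_of_le {I : Type u} [Finite I] {p : Set (I → ℝ)} (hp : IsPolyhedron p)
    (hne : p.Nonempty) (c : I → ℝ) (M : ℝ) (h : ∀ y ∈ p, dot c y ≤ M) : (face p c).Nonempty := by
  obtain ⟨m, a, b, rfl⟩ := hp
  obtain ⟨y0, hy0⟩ := hne
  set p := {y | ∀ i, dot (a i) y ≤ b i} with hp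
  have hbdd : BddAbove (dot c '' p) := ⟨M, by rintro _ ⟨y, hy, rfl⟩; exact h y hy⟩
  have hle : ∀ y ∈ p, dot c y ≤ sSup (dot c '' p) := fun y hy => le_csSup hbdd ⟨y, hy, rfl⟩
  by_contra hemp
  obtain ⟨l, hl, hl0, hlb⟩ := farkas_infeasible (Fin.cons ((-1 : ℝ) • c) a)
    (Fin.cons (-sSup (dot c '' p)) b) (by
      intro y hy
      simp only [Fin.forall_fin_succ, Fin.cons_zero, Fin.cons_succ, smul_dot] at hy
      refine hemp ⟨y, hy.2, fun z hz => ?_⟩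
      linarith [hle z hz])
  simp only [Fin.sum_univ_succ, Fin.cons_zero, Fin.cons_succ, smul_dot] at hl0 hlb
  have key : ∀ y ∈ p, l 0 * dot c y ≤ ∑ i : Fin m, l i.succ * b i := fun y hy => by
    have h1 := hl0 y
    have h2 : ∑ i : Fin m, l i.succ * dot (a i) y ≤ ∑ i : Fin m, l i.succ * b i :=
      Finset.sum_le_sum fun i _ => mul_le_mul_of_nonneg_left (hy i) (hl _)
    linarith
  rcases (hl 0).eq_or_lt with h0 | h0
  · have := key y0 hy0
    rw [← h0] at this hlb
    linarith
  · have : sSup (dot c '' p) ≤ (∑ i : Fin m, l i.succ * b i) / l 0 :=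
      csSup_le ⟨_, y0, hy0, rfl⟩ (by
        rintro _ ⟨y, hy, rfl⟩
        rw [le_div_iff₀ h0, mul_comm]
        exact key y hy)
    rw [le_div_iff₀ h0] at this
    linarith

/-- The support of the normal fan of a nonempty polyhedron is the polar of its recession cone. -/
lemma exists_recession {I : Type u} [Finite I] {p : Set (I → ℝ)} (hp : IsPolyhedron p)
    (hne : p.Nonempty) :
    ∃ R : Set (I → ℝ), ∀ c, (face p c).Nonempty ↔ ∀ y ∈ R, dot c y ≤ 0 := by
  have hp' := hp
  obtain ⟨m, a, b, rfl⟩ := hp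
  refine ⟨{y | ∀ i, dot (a i) y ≤ 0}, fun c => ⟨?_, fun h => ?_⟩⟩
  · rintro ⟨y0, hy0, hmax⟩ y hy
    have := hmax (y0 + y) (fun i => by rw [dot_add]; linarith [hy0 i, hy i])
    rw [dot_add] at this
    linarith
  · obtain ⟨l, hl, hB⟩ := farkas m (fun i => dotLin (a i)) (dotLin c) h
    refine face_nonempty_of_le hp' hne c (∑ i, l i * b i) fun y hy => ?_
    have := hB y
    simp only [dotLin, LinearMap.coe_mk, AddHom.coe_mk] at this
    rw [this]
    exact Finset.sum_le_sum fun i _ => mul_le_mul_of_nonneg_left (hy i) (hl _)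

/-- Faces of a face `face p d` are faces of `p`. -/
lemma face_face {I : Type u} [Finite I] {p : Set (I → ℝ)} (hp : IsPolyhedron p) (d c : I → ℝ)
    (h : (face (face p d) c).Nonempty) :
    ∃ C0 : ℝ, ∀ C, C0 < C → face p (c + C • d) = face (face p d) c := by
  obtain ⟨m, a, b, rfl⟩ := hp
  set p := {y | ∀ i, dot (a i) y ≤ b i} with hp
  obtain ⟨z, ⟨hz, hzd⟩, hzc⟩ := h
  have heq : ∀ y, (∀ i, dot ((Fin.cons ((-1 : ℝ) • d) a : Fin (m + 1) → I → ℝ) i) y ≤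
      (Fin.cons (-dot d z) b : Fin (m + 1) → ℝ) i) → y ∈ face p d := by
    intro y hy
    simp only [Fin.forall_fin_succ, Fin.cons_zero, Fin.cons_succ, smul_dot] at hy
    exact ⟨hy.2, fun z' hz' => by linarith [hzd z' hz']⟩
  obtain ⟨l, hl, hlc, hlb⟩ := farkas_affine (Fin.cons ((-1 : ℝ) • d) a) (Fin.cons (-dot d z) b)
    ⟨z, by
      simp only [Fin.forall_fin_succ, Fin.cons_zero, Fin.cons_succ, smul_dot]
      exact ⟨by linarith, hz⟩⟩ c (dot c z) (fun y hy => hzc y (heq y hy))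
  simp only [Fin.sum_univ_succ, Fin.cons_zero, Fin.cons_succ, smul_dot] at hlc hlb
  have key : ∀ y ∈ p, dot c y + l 0 * dot d y ≤ dot c z + l 0 * dot d z := fun y hy => by
    have h1 := hlc y
    have h2 : ∑ i : Fin m, l i.succ * dot (a i) y ≤ ∑ i : Fin m, l i.succ * b i :=
      Finset.sum_le_sum fun i _ => mul_le_mul_of_nonneg_left (hy i) (hl _)
    linarith
  refine ⟨l 0, fun C hC => Set.ext fun y => ⟨fun hy => ?_, fun hy => ?_⟩⟩
  · obtain ⟨hyp, hy⟩ := hy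
    have h1 := hy z hz
    simp only [add_dot, smul_dot] at h1
    have h2 := key y hyp
    have h3 := hzd y hyp
    have h4 : dot d z ≤ dot d y := by
      by_contra hn
      push Not at hn
      nlinarith
    have h5 : dot d y = dot d z := le_antisymm h3 h4
    rw [h5] at h1 h2
    refine ⟨⟨hyp, fun z' hz' => ?_⟩, fun z' hz' => ?_⟩
    · rw [h5]; exact hzd z' hz'
    · have := hzc z' hz'
      linarith
  · obtain ⟨⟨hyp, hyd⟩, hyc⟩ := hy
    have h1 : dot d y = dot d z := le_antisymm (hzd y hyp) (hyd z hz)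
    have h2 := hyc z ⟨hz, hzd⟩
    refine ⟨hyp, fun z' hz' => ?_⟩
    simp only [add_dot, smul_dot]
    have h3 := key z' hz'
    have h4 := hzd z' hz'
    rw [h1]
    nlinarith

/-- If a face of `p` in direction `c + C • d` lies in `face p d`, it is a face of the latter. -/
lemma face_eq_of_subset {I : Type u} [Finite I] {p : Set (I → ℝ)} (d c : I → ℝ) (C : ℝ)
    (hne : (face p (c + C • d)).Nonempty) (h : face p (c + C • d) ⊆ face p d) :
    face (face p d) c = face p (c + C • d) := by
  obtain ⟨z, hz⟩ := hne
  have hzd := h hz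
  ext y
  constructor
  · rintro ⟨⟨hyp, hyd⟩, hyc⟩
    refine ⟨hyp, fun z' hz' => (hz.2 z' hz').trans ?_⟩
    have h1 : dot d y = dot d z := le_antisymm (hzd.2 y hyp) (hyd z hzd.1)
    have h2 := hyc z hzd
    simp only [add_dot, smul_dot, h1]
    linarith
  · intro hy
    have hyd := h hy
    refine ⟨hyd, fun z' hz' => ?_⟩
    have h1 : dot d z' = dot d y := le_antisymm (hyd.2 z' hz'.1) (hz'.2 y hyd.1)
    have h2 := hy.2 z' hz'.1
    simp only [add_dot, smul_dot, h1] at h2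
    linarith

/-! ### Auxiliary facts on extended generalized permutahedra -/

lemma mem_sUnion_normalFan {I : Type u} {p : Set (I → ℝ)} {x : I → ℝ} :
    x ∈ ⋃₀ normalFan p ↔ (face p x).Nonempty := by
  constructor
  · rintro ⟨N, ⟨y, hy, rfl⟩, hx⟩
    have : face p x = face p y := hx
    rwa [this]
  · intro h
    exact ⟨_, ⟨x, h, rfl⟩, rfl⟩

lemma mem_braidFace_self {I : Type u} (x : I → ℝ) : x ∈ braidFace x := fun _ _ => Iff.rfl

lemma IsEGP.face_eq {I : Type u} {p : Set (I → ℝ)} (hp : IsEGP p) {x y : I → ℝ}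
    (hxy : y ∈ braidFace x) (hx : (face p x).Nonempty) : face p y = face p x := by
  obtain ⟨-, -, F, hF, hs, hc⟩ := hp
  have h1 : x ∈ ⋃₀ F := hs ▸ mem_sUnion_normalFan.2 hx
  obtain ⟨σ, hσ, hxσ⟩ := h1
  obtain ⟨z, rfl⟩ := hF.subset hσ
  obtain ⟨N, ⟨t, -, rfl⟩, hsub⟩ := hc _ hσ
  have hy : y ∈ braidFace z := fun i j => (hxy i j).trans (hxσ i j)
  exact Eq.trans (hsub hy) (Eq.symm (hsub hxσ))

lemma isEGP_of_face_eq {I : Type u} [Finite I] {p : Set (I → ℝ)} (hp : IsPolyhedron p)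
    (hne : p.Nonempty)
    (h : ∀ x y, y ∈ braidFace x → (face p x).Nonempty → face p y = face p x) : IsEGP p := by
  obtain ⟨R, hR⟩ := exists_recession hp hne
  have hU : ⋃₀ {σ | ∃ x, (face p x).Nonempty ∧ σ = braidFace x} = {x | (face p x).Nonempty} := by
    ext x
    constructor
    · rintro ⟨σ, ⟨z, hz, rfl⟩, hx⟩
      change (face p x).Nonempty
      rwa [h z x hx hz]
    · exact fun hx => ⟨_, ⟨x, hx, rfl⟩, mem_braidFace_self x⟩
  refine ⟨hp, hne, {σ | ∃ x, (face p x).Nonempty ∧ σ = braidFace x}, ⟨?_, ?_, ?_⟩, ?_, ?_⟩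
  · rintro _ ⟨x, -, rfl⟩
    exact ⟨x, rfl⟩
  · rintro _ ⟨x, hx, rfl⟩ _ ⟨z, rfl⟩ hτ
    refine ⟨z, (hR z).2 fun y hy => ?_, rfl⟩
    have hz := hτ (mem_braidFace_self z)
    have hcl : IsClosed {c : I → ℝ | dot c y ≤ 0} := isClosed_le (continuous_dot y) continuous_const
    refine hcl.closure_subset_iff.2 (fun c hc => ?_) hz
    exact (hR c).1 (by rwa [h x c hc hx]) y hy
  · rw [hU]
    intro x hx y hy s t hs ht _
    refine (hR _).2 fun z hz => ?_
    rw [add_dot, smul_dot, smul_dot]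
    have h1 := (hR _).1 hx z hz
    have h2 := (hR _).1 hy z hz
    nlinarith
  · rw [hU]
    ext x
    exact mem_sUnion_normalFan
  · rintro _ ⟨x, hx, rfl⟩
    exact ⟨_, ⟨x, hx, rfl⟩, fun y hy => h x y hy hx⟩
lemma dot_sum {I J : Type u} [Finite I] [Finite J] (x y : I ⊕ J → ℝ) :
    dot x y = dot (x ∘ Sum.inl) (y ∘ Sum.inl) + dot (x ∘ Sum.inr) (y ∘ Sum.inr) := by
  cases nonempty_fintype I
  cases nonempty_fintype J
  simp [dot, finsum_eq_sum_of_fintype]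

lemma dot_comp_equiv {I J : Type u} (e : I ≃ J) (x y : J → ℝ) :
    dot (x ∘ e) (y ∘ e) = dot x y :=
  finsum_comp_equiv e (f := fun j => x j * y j)

/-- The transport of a subset of `ℝ^I` along a bijection `I ≃ J`. -/
def relabelSet {I J : Type u} (e : I ≃ J) (p : Set (I → ℝ)) : Set (J → ℝ) := {y | y ∘ e ∈ p}

/-- The Cartesian product of `p ⊆ ℝ^I` and `q ⊆ ℝ^J`, as a subset of `ℝ^(I ⊔ J)`. -/
def prodSet {I J : Type u} (p : Set (I → ℝ)) (q : Set (J → ℝ)) : Set (I ⊕ J → ℝ) :=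
  {y | y ∘ Sum.inl ∈ p ∧ y ∘ Sum.inr ∈ q}

/-- The indicator vector of `I` in `ℝ^(I ⊔ J)`. -/
def indicatorLeft (I J : Type u) : I ⊕ J → ℝ := Sum.elim 1 0

/-- `p|I`: the projection to `ℝ^I` of the face of `p` that maximizes the sum of the coordinates
in `I`. -/
def restrSet {I J : Type u} (p : Set (I ⊕ J → ℝ)) : Set (I → ℝ) :=
  (fun y => y ∘ Sum.inl) '' face p (indicatorLeft I J)

/-- `p/I`: the projection to `ℝ^J` of the face of `p` that maximizes the sum of the coordinates
in `I`. -/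
def contrSet {I J : Type u} (p : Set (I ⊕ J → ℝ)) : Set (J → ℝ) :=
  (fun y => y ∘ Sum.inr) '' face p (indicatorLeft I J)

lemma face_relabelSet {I J : Type u} (e : I ≃ J) (p : Set (I → ℝ)) (x : J → ℝ) :
    face (relabelSet e p) x = relabelSet e (face p (x ∘ e)) := by
  ext y
  simp only [face, relabelSet, Set.mem_ofPred_eq, dot_comp_equiv]
  refine and_congr_right fun _ => ⟨fun h z hz => ?_, fun h z hz => ?_⟩
  · have h1 := h (z ∘ e.symm) (by simpa [Function.comp_assoc] using hz)
    rw [← dot_comp_equiv e] at h1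
    simpa [Function.comp_assoc, dot_comp_equiv] using h1
  · have h1 := h (z ∘ e) hz
    rwa [dot_comp_equiv] at h1

lemma IsEGP.relabel {I J : Type u} [Finite I] [Finite J] {p : Set (I → ℝ)} (hp : IsEGP p)
    (e : I ≃ J) : IsEGP (relabelSet e p) := by
  refine isEGP_of_face_eq ?_ ?_ ?_
  · obtain ⟨m, a, b, rfl⟩ := hp.1
    refine ⟨m, fun i => a i ∘ e.symm, b, ?_⟩
    ext y
    refine forall_congr' fun i => ?_
    rw [← dot_comp_equiv e.symm]
    simp [Function.comp_assoc]
  · obtain ⟨y, hy⟩ := hp.2.1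
    exact ⟨y ∘ e.symm, by simpa [relabelSet, Function.comp_assoc] using hy⟩
  · intro x y hxy hx
    rw [face_relabelSet] at hx
    rw [face_relabelSet, face_relabelSet]
    obtain ⟨z, hz⟩ := hx
    rw [hp.face_eq (x := x ∘ e) (y := y ∘ e) (fun i j => hxy _ _) ⟨_, hz⟩]

lemma face_prodSet {I J : Type u} [Finite I] [Finite J] (p : Set (I → ℝ)) (q : Set (J → ℝ))
    (x : I ⊕ J → ℝ) :
    face (prodSet p q) x = prodSet (face p (x ∘ Sum.inl)) (face q (x ∘ Sum.inr)) := by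
  ext y
  constructor
  · rintro ⟨⟨hp, hq⟩, h⟩
    refine ⟨⟨hp, fun z hz => ?_⟩, ⟨hq, fun z hz => ?_⟩⟩
    · have := h (Sum.elim z (y ∘ Sum.inr)) ⟨hz, hq⟩
      simp only [dot_sum, Sum.elim_comp_inl, Sum.elim_comp_inr] at this
      linarith
    · have := h (Sum.elim (y ∘ Sum.inl) z) ⟨hp, hz⟩
      simp only [dot_sum, Sum.elim_comp_inl, Sum.elim_comp_inr] at this
      linarith
  · rintro ⟨⟨hp, h1⟩, ⟨hq, h2⟩⟩
    refine ⟨⟨hp, hq⟩, fun z hz => ?_⟩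
    simp only [dot_sum]
    linarith [h1 _ hz.1, h2 _ hz.2]

lemma IsEGP.prod {I J : Type u} [Finite I] [Finite J] {p : Set (I → ℝ)} {q : Set (J → ℝ)}
    (hp : IsEGP p) (hq : IsEGP q) : IsEGP (prodSet p q) := by
  refine isEGP_of_face_eq ?_ ?_ ?_
  · obtain ⟨m, a, b, rfl⟩ := hp.1
    obtain ⟨n, c, d, rfl⟩ := hq.1
    refine ⟨m + n, Fin.append (fun i => Sum.elim (a i) 0) (fun i => Sum.elim 0 (c i)),
      Fin.append b d, ?_⟩
    ext y
    simp only [prodSet, Set.mem_ofPred_eq]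
    constructor
    · rintro ⟨h1, h2⟩ i
      refine Fin.addCases (fun i => ?_) (fun i => ?_) i
      · simpa [dot_sum, zero_dot] using h1 i
      · simpa [dot_sum, zero_dot] using h2 i
    · intro h
      exact ⟨fun i => by simpa [dot_sum, zero_dot] using h (Fin.castAdd n i),
        fun i => by simpa [dot_sum, zero_dot] using h (Fin.natAdd m i)⟩
  · obtain ⟨y, hy⟩ := hp.2.1
    obtain ⟨z, hz⟩ := hq.2.1
    exact ⟨Sum.elim y z, hy, hz⟩
  · intro x y hxy hx
    rw [face_prodSet] at hx
    rw [face_prodSet, face_prodSet]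
    obtain ⟨z, hz⟩ := hx
    rw [hp.face_eq (x := x ∘ Sum.inl) (y := y ∘ Sum.inl) (fun i j => hxy _ _) ⟨_, hz.1⟩,
      hq.face_eq (x := x ∘ Sum.inr) (y := y ∘ Sum.inr) (fun i j => hxy _ _) ⟨_, hz.2⟩]

/-- After adding a large multiple of the indicator vector of `I`, the braid face of a vector is
determined by the braid faces of its two parts. -/
lemma exists_braidFace_add {I J : Type u} [Finite I] [Finite J] {x x' : I → ℝ} {y y' : J → ℝ}
    (hx : x' ∈ braidFace x) (hy : y' ∈ braidFace y) :
    ∃ C1 : ℝ, ∀ C, C1 < C → Sum.elim x' y' + C • indicatorLeft I J ∈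
      braidFace (Sum.elim x y + C • indicatorLeft I J) := by
  obtain ⟨c, hc⟩ := (Set.finite_range fun t : I × J => y t.2 - x t.1).bddAbove
  obtain ⟨c', hc'⟩ := (Set.finite_range fun t : I × J => y' t.2 - x' t.1).bddAbove
  refine ⟨max c c', fun C hC => ?_⟩
  have h1 : ∀ i j, y j < x i + C := fun i j => by
    have := hc ⟨(i, j), rfl⟩
    have := (le_max_left c c').trans_lt hC
    simp only at *
    linarith
  have h2 : ∀ i j, y' j < x' i + C := fun i j => by
    have := hc' ⟨(i, j), rfl⟩
    have := (le_max_right c c').trans_lt hC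
    simp only at *
    linarith
  rintro (i | i) (j | j)
  · simpa [indicatorLeft] using hx i j
  · simp [indicatorLeft, (h1 i j).not_gt, (h2 i j).not_gt]
  · simp [indicatorLeft, h1 j i, h2 j i]
  · simpa [indicatorLeft] using hy i j

/-- The dependence on a direction of the faces of `face p (indicatorLeft I J)`. -/
lemma IsEGP.face_face_eq {I J : Type u} [Finite I] [Finite J] {p : Set (I ⊕ J → ℝ)}
    (hp : IsEGP p) {x x' : I → ℝ} {y y' : J → ℝ} (hx : x' ∈ braidFace x) (hy : y' ∈ braidFace y)
    (h : (face (face p (indicatorLeft I J)) (Sum.elim x y)).Nonempty) :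
    face (face p (indicatorLeft I J)) (Sum.elim x' y') =
      face (face p (indicatorLeft I J)) (Sum.elim x y) := by
  obtain ⟨C0, hC0⟩ := face_face hp.1 _ _ h
  obtain ⟨C1, hC1⟩ := exists_braidFace_add hx hy
  have h0 := hC0 (max C0 C1 + 1) (by linarith [le_max_left C0 C1])
  have h1 := hp.face_eq (hC1 (max C0 C1 + 1) (by linarith [le_max_right C0 C1])) (by rwa [h0])
  rw [h0] at h1
  rw [← h1]
  refine face_eq_of_subset _ _ _ (by rwa [h1]) ?_
  rw [h1]
  exact fun z hz => hz.1

lemma IsEGP.glue {I J : Type u} [Finite I] [Finite J] {p : Set (I ⊕ J → ℝ)} (hp : IsEGP p)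
    {y z : I ⊕ J → ℝ} (hy : y ∈ face p (indicatorLeft I J))
    (hz : z ∈ face p (indicatorLeft I J)) :
    Sum.elim (y ∘ Sum.inl) (z ∘ Sum.inr) ∈ face p (indicatorLeft I J) := by
  have hq := hp.1.face (indicatorLeft I J) ⟨y, hy⟩
  have hq' := hq
  obtain ⟨m, a, b, hab⟩ := hq'
  rw [hab]
  intro i
  have hle : ∀ t ∈ face p (indicatorLeft I J), dot (a i) t ≤ b i := fun t ht => by
    rw [hab] at ht
    exact ht i
  set u := a i ∘ Sum.inl with hu
  set v := a i ∘ Sum.inr with hv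
  have hai : a i = Sum.elim u v := by rw [hu, hv, Sum.elim_comp_inl_inr]
  have hne := face_nonempty_of_le hq ⟨y, hy⟩ (a i) (b i) hle
  obtain ⟨t, ht⟩ := hne
  have hs : ∀ s : ℝ, 0 < s → ∀ z' ∈ face p (indicatorLeft I J),
      s * dot u (z' ∘ Sum.inl) + dot v (z' ∘ Sum.inr) ≤
        s * dot u (t ∘ Sum.inl) + dot v (t ∘ Sum.inr) := by
    intro s hs z' hz'
    have h1 : s • u ∈ braidFace u := fun i j => by
      simp [mul_lt_mul_iff_right₀ hs]
    have h2 := hp.face_face_eq h1 (mem_braidFace_self v) (by rw [← hai]; exact ⟨t, ht⟩)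
    rw [← hai] at h2
    rw [← h2] at ht
    have h3 := ht.2 z' hz'
    simpa only [dot_sum, Sum.elim_comp_inl, Sum.elim_comp_inr, smul_dot] using h3
  have hA : dot u (y ∘ Sum.inl) ≤ dot u (t ∘ Sum.inl) := by
    by_contra hn
    push Not at hn
    set A := dot u (y ∘ Sum.inl) - dot u (t ∘ Sum.inl) with hA
    set B := dot v (y ∘ Sum.inr) - dot v (t ∘ Sum.inr) with hB
    have hA0 : 0 < A := sub_pos.2 hn
    have h1 := hs ((|B| + 1) / A) (by positivity) y hy
    have h2 : (|B| + 1) / A * A = |B| + 1 := div_mul_cancel₀ _ hA0.ne'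
    rw [hA, mul_sub] at h2
    have h3 := neg_abs_le B
    linarith
  have hB : dot v (z ∘ Sum.inr) ≤ dot v (t ∘ Sum.inr) := by
    by_contra hn
    push Not at hn
    set A := dot u (z ∘ Sum.inl) - dot u (t ∘ Sum.inl) with hA
    set B := dot v (z ∘ Sum.inr) - dot v (t ∘ Sum.inr) with hB
    have hB0 : 0 < B := sub_pos.2 hn
    have h1 := hs (B / (|A| + 1)) (by positivity) z hz
    have h2 : B / (|A| + 1) * (|A| + 1) = B := div_mul_cancel₀ _ (by positivity)
    have h4 : 0 < B / (|A| + 1) := by positivity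
    have h5 : B / (|A| + 1) * (-|A|) ≤ B / (|A| + 1) * A :=
      mul_le_mul_of_nonneg_left (neg_abs_le A) h4.le
    have h6 : B / (|A| + 1) * A = B / (|A| + 1) * dot u (z ∘ Sum.inl) -
      B / (|A| + 1) * dot u (t ∘ Sum.inl) := by rw [hA, mul_sub]
    linarith
  have h1 := hle t ht.1
  rw [hai, dot_sum] at h1 ⊢
  simp only [Sum.elim_comp_inl, Sum.elim_comp_inr] at h1 ⊢
  linarith

/-- The face of `p` in the direction of the indicator vector of `I` is `p|I × p/I`. -/
lemma IsEGP.face_eq_prodSet {I J : Type u} [Finite I] [Finite J] {p : Set (I ⊕ J → ℝ)}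
    (hp : IsEGP p) : face p (indicatorLeft I J) = prodSet (restrSet p) (contrSet p) := by
  ext y
  constructor
  · exact fun hy => ⟨⟨y, hy, rfl⟩, ⟨y, hy, rfl⟩⟩
  · rintro ⟨⟨y1, h1, e1⟩, ⟨y2, h2, e2⟩⟩
    have := hp.glue h1 h2
    simp only at e1 e2
    rwa [e1, e2, Sum.elim_comp_inl_inr] at this

lemma IsEGP.restr {I J : Type u} [Finite I] [Finite J] {p : Set (I ⊕ J → ℝ)} (hp : IsEGP p)
    (h : (face p (indicatorLeft I J)).Nonempty) : IsEGP (restrSet p) := by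
  obtain ⟨z, hz⟩ := h
  have hzc : z ∘ Sum.inr ∈ contrSet p := ⟨z, hz, rfl⟩
  have heq := hp.face_eq_prodSet
  refine isEGP_of_face_eq ?_ ⟨_, z, hz, rfl⟩ ?_
  · obtain ⟨m, a, b, hab⟩ := hp.1.face _ ⟨z, hz⟩
    refine ⟨m, fun i => a i ∘ Sum.inl, fun i => b i - dot (a i ∘ Sum.inr) (z ∘ Sum.inr), ?_⟩
    ext x
    have h1 : x ∈ restrSet p ↔ Sum.elim x (z ∘ Sum.inr) ∈ face p (indicatorLeft I J) := by
      rw [heq]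
      simp [prodSet, hzc]
    rw [h1, hab]
    refine forall_congr' fun i => ?_
    rw [dot_sum]
    simp [le_sub_iff_add_le]
  · intro x x' hx hne
    have hf : ∀ x, face (face p (indicatorLeft I J)) (Sum.elim x 0) =
        prodSet (face (restrSet p) x) (contrSet p) := fun x => by
      rw [heq, face_prodSet]
      simp [face, zero_dot]
    have h0 := hp.face_face_eq hx (mem_braidFace_self (0 : J → ℝ)) (by
      obtain ⟨t, ht⟩ := hne
      rw [hf]
      exact ⟨Sum.elim t (z ∘ Sum.inr), by simpa [prodSet] using ⟨ht, hzc⟩⟩)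
    rw [hf, hf] at h0
    ext t
    have := congrArg (Sum.elim t (z ∘ Sum.inr) ∈ ·) h0
    simpa [prodSet, hzc] using this

lemma IsEGP.contr {I J : Type u} [Finite I] [Finite J] {p : Set (I ⊕ J → ℝ)} (hp : IsEGP p)
    (h : (face p (indicatorLeft I J)).Nonempty) : IsEGP (contrSet p) := by
  obtain ⟨z, hz⟩ := h
  have hzc : z ∘ Sum.inl ∈ restrSet p := ⟨z, hz, rfl⟩
  have heq := hp.face_eq_prodSet
  refine isEGP_of_face_eq ?_ ⟨_, z, hz, rfl⟩ ?_
  · obtain ⟨m, a, b, hab⟩ := hp.1.face _ ⟨z, hz⟩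
    refine ⟨m, fun i => a i ∘ Sum.inr, fun i => b i - dot (a i ∘ Sum.inl) (z ∘ Sum.inl), ?_⟩
    ext x
    have h1 : x ∈ contrSet p ↔ Sum.elim (z ∘ Sum.inl) x ∈ face p (indicatorLeft I J) := by
      rw [heq]
      simp [prodSet, hzc]
    rw [h1, hab]
    refine forall_congr' fun i => ?_
    rw [dot_sum]
    simp [le_sub_iff_add_le, add_comm]
  · intro x x' hx hne
    have hf : ∀ x, face (face p (indicatorLeft I J)) (Sum.elim 0 x) =
        prodSet (restrSet p) (face (contrSet p) x) := fun x => by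
      rw [heq, face_prodSet]
      simp [face, zero_dot]
    have h0 := hp.face_face_eq (mem_braidFace_self (0 : I → ℝ)) hx (by
      obtain ⟨t, ht⟩ := hne
      rw [hf]
      exact ⟨Sum.elim (z ∘ Sum.inl) t, by simpa [prodSet] using ⟨hzc, ht⟩⟩)
    rw [hf, hf] at h0
    ext t
    have := congrArg (Sum.elim (z ∘ Sum.inl) t ∈ ·) h0
    simpa [prodSet, hzc] using this

lemma isEGP_univ_of_isEmpty {I : Type u} [IsEmpty I] : IsEGP (Set.univ : Set (I → ℝ)) :=
  isEGP_of_face_eq ⟨0, fun i => i.elim0, fun i => i.elim0, by simp⟩ Set.univ_nonempty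
    fun x y _ _ => by rw [Subsingleton.elim x y]

/-! ### Extended generalized permutahedra and their operations -/

/-- The set of extended generalized permutahedra in `ℝ^I`. -/
def EGP (I : Type u) : Type u := {p : Set (I → ℝ) // IsEGP p}

/-- Relabelling of an extended generalized permutahedron along a bijection. -/
def EGP.relabel {I J : Type u} [Finite I] [Finite J] (e : I ≃ J) (p : EGP I) : EGP J :=
  ⟨relabelSet e p.1, p.2.relabel e⟩

/-- The Cartesian product `p × q`. -/
def EGP.prod {I J : Type u} [Finite I] [Finite J] (p : EGP I) (q : EGP J) : EGP (I ⊕ J) :=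
  ⟨prodSet p.1 q.1, p.2.prod q.2⟩

/-- `p` is bounded above in the direction of the indicator vector of `I`, that is, the
corresponding maximizing face is not empty. -/
def EGP.BoundedLeft {I J : Type u} (p : EGP (I ⊕ J)) : Prop :=
  (face p.1 (indicatorLeft I J)).Nonempty

/-- The restriction `p|I`. -/
def EGP.restr {I J : Type u} [Finite I] [Finite J] (p : EGP (I ⊕ J)) (h : p.BoundedLeft) :
    EGP I := ⟨restrSet p.1, p.2.restr h⟩

/-- The contraction `p/I`. -/
def EGP.contr {I J : Type u} [Finite I] [Finite J] (p : EGP (I ⊕ J)) (h : p.BoundedLeft) :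
    EGP J := ⟨contrSet p.1, p.2.contr h⟩

/-- The only extended generalized permutahedron in `ℝ^∅`: a point. -/
def EGP.point : EGP PEmpty.{u + 1} := ⟨Set.univ, isEGP_univ_of_isEmpty⟩

/-! ### Linear orders -/

/-- The set of linear orders on `I`; `w.1 i j` means that `i` comes before `j` in `w` or `i = j`. -/
def LinearOrd (I : Type u) : Type u := {r : I → I → Prop // IsLinearOrder I r}

/-- The linear order induced on `J` by a linear order on `I` and an injection `J → I`. -/
def LinearOrd.comap {I J : Type u} (f : J → I) (hf : Function.Injective f) (w : LinearOrd I) :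
    LinearOrd J :=
  ⟨Function.onFun w.1 f, @Function.Injective.isLinearOrder_onFun _ _ w.1 f hf w.2⟩

/-- Relabelling of a linear order along a bijection. -/
def LinearOrd.relabel {I J : Type u} (e : I ≃ J) (w : LinearOrd I) : LinearOrd J :=
  w.comap e.symm e.symm.injective

/-- The restriction of a linear order on `I ⊔ J` to `I`. -/
def LinearOrd.left {I J : Type u} (v : LinearOrd (I ⊕ J)) : LinearOrd I := v.comap Sum.inl Sum.inl_injective

/-- The restriction of a linear order on `I ⊔ J` to `J`. -/
def LinearOrd.right {I J : Type u} (v : LinearOrd (I ⊕ J)) : LinearOrd J :=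
  v.comap Sum.inr Sum.inr_injective

/-- The restriction of `v` to `I` is an initial segment of `v`. -/
def LinearOrd.LeftInitial {I J : Type u} (v : LinearOrd (I ⊕ J)) : Prop :=
  ∀ (i : I) (j : J), v.1 (Sum.inl i) (Sum.inr j)

/-- The shuffles of `w` and `t`. -/
def shuffles {I J : Type u} (w : LinearOrd I) (t : LinearOrd J) : Set (LinearOrd (I ⊕ J)) :=
  {v | v.left = w ∧ v.right = t}

instance {I : Type u} [Finite I] : Finite (LinearOrd I) := by
  unfold LinearOrd
  infer_instance

/-- The linear order on the empty set. -/
def LinearOrd.empty : LinearOrd PEmpty.{u + 1} :=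
  ⟨fun _ _ => True, { refl := fun i => i.elim, trans := fun i => i.elim,
                      antisymm := fun i => i.elim, total := fun i => i.elim }⟩

/-! ### Hopf monoids in vector species -/

/-- The data of a Hopf monoid in vector species over `k`: the vector spaces `H[I]` for all finite
sets `I`, their relabelling maps, products, coproducts, unit and counit. The unit
species is concentrated on the empty set, where it is `k`, so that the unit is given by an element
of `H[∅]` and the counit by a linear form on `H[∅]`. -/
structure HopfMonoidData (k : Type v) [Field k] where
  obj : (I : Type u) → [Finite I] → Type w
  [addCommGroup : ∀ (I : Type u) [Finite I], AddCommGroup (obj I)]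
  [module : ∀ (I : Type u) [Finite I], Module k (obj I)]
  map : ∀ {I J : Type u} [Finite I] [Finite J], I ≃ J → (obj I →ₗ[k] obj J)
  mul : ∀ (I J : Type u) [Finite I] [Finite J], obj I ⊗[k] obj J →ₗ[k] obj (I ⊕ J)
  comul : ∀ (I J : Type u) [Finite I] [Finite J], obj (I ⊕ J) →ₗ[k] obj I ⊗[k] obj J
  one : obj PEmpty.{u + 1}
  counit : obj PEmpty.{u + 1} →ₗ[k] k

attribute [instance] HopfMonoidData.addCommGroup HopfMonoidData.module

/-- The axioms of a connected Hopf monoid in vector species: functoriality, naturality,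
(co)associativity, (co)unitality, the compatibility of products and coproducts, and `H[∅] = k`.
(In the connected case the antipode exists and is given by Takeuchi's formula in terms of the
products and coproducts.) -/
structure IsHopfMonoid {k : Type v} [Field k] (H : HopfMonoidData.{u, v, w} k) : Prop where
  map_refl : ∀ (I : Type u) [Finite I], H.map (Equiv.refl I) = LinearMap.id
  map_trans : ∀ {I J K : Type u} [Finite I] [Finite J] [Finite K] (e : I ≃ J) (f : J ≃ K),
    H.map (e.trans f) = H.map f ∘ₗ H.map e
  mul_natural : ∀ {I J I' J' : Type u} [Finite I] [Finite J] [Finite I'] [Finite J']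
    (e : I ≃ I') (f : J ≃ J'),
    H.map (Equiv.sumCongr e f) ∘ₗ H.mul I J =
      H.mul I' J' ∘ₗ TensorProduct.map (H.map e) (H.map f)
  comul_natural : ∀ {I J I' J' : Type u} [Finite I] [Finite J] [Finite I'] [Finite J']
    (e : I ≃ I') (f : J ≃ J'),
    H.comul I' J' ∘ₗ H.map (Equiv.sumCongr e f) =
      TensorProduct.map (H.map e) (H.map f) ∘ₗ H.comul I J
  mul_assoc : ∀ (I J K : Type u) [Finite I] [Finite J] [Finite K],
    H.map (Equiv.sumAssoc I J K) ∘ₗ H.mul (I ⊕ J) K ∘ₗ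
        TensorProduct.map (H.mul I J) LinearMap.id =
      H.mul I (J ⊕ K) ∘ₗ TensorProduct.map LinearMap.id (H.mul J K) ∘ₗ
        (TensorProduct.assoc k (H.obj I) (H.obj J) (H.obj K)).toLinearMap
  comul_assoc : ∀ (I J K : Type u) [Finite I] [Finite J] [Finite K],
    TensorProduct.map LinearMap.id (H.comul J K) ∘ₗ H.comul I (J ⊕ K) ∘ₗ
        H.map (Equiv.sumAssoc I J K) =
      (TensorProduct.assoc k (H.obj I) (H.obj J) (H.obj K)).toLinearMap ∘ₗ
        TensorProduct.map (H.comul I J) LinearMap.id ∘ₗ H.comul (I ⊕ J) K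
  one_mul : ∀ (I : Type u) [Finite I] (x : H.obj I),
    H.map (Equiv.emptySum PEmpty I) (H.mul PEmpty I (H.one ⊗ₜ[k] x)) = x
  mul_one : ∀ (I : Type u) [Finite I] (x : H.obj I),
    H.map (Equiv.sumEmpty I PEmpty) (H.mul I PEmpty (x ⊗ₜ[k] H.one)) = x
  counit_comul : ∀ (I : Type u) [Finite I] (x : H.obj I),
    TensorProduct.lid k (H.obj I) (TensorProduct.map H.counit LinearMap.id
      (H.comul PEmpty I (H.map (Equiv.emptySum PEmpty I).symm x))) = x
  comul_counit : ∀ (I : Type u) [Finite I] (x : H.obj I),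
    TensorProduct.rid k (H.obj I) (TensorProduct.map LinearMap.id H.counit
      (H.comul I PEmpty (H.map (Equiv.sumEmpty I PEmpty).symm x))) = x
  comul_mul : ∀ (A B C D : Type u) [Finite A] [Finite B] [Finite C] [Finite D],
    H.comul (A ⊕ C) (B ⊕ D) ∘ₗ H.map (Equiv.sumSumSumComm A B C D) ∘ₗ
        H.mul (A ⊕ B) (C ⊕ D) =
      TensorProduct.map (H.mul A C) (H.mul B D) ∘ₗ
        (TensorProduct.tensorTensorTensorComm k (H.obj A) (H.obj B)
          (H.obj C) (H.obj D)).toLinearMap ∘ₗ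
        TensorProduct.map (H.comul A B) (H.comul C D)
  comul_one : H.comul PEmpty PEmpty (H.map (Equiv.sumEmpty PEmpty PEmpty).symm H.one) =
    H.one ⊗ₜ[k] H.one
  counit_mul : ∀ x y : H.obj PEmpty,
    H.counit (H.map (Equiv.sumEmpty PEmpty PEmpty) (H.mul PEmpty PEmpty (x ⊗ₜ[k] y))) =
      H.counit x * H.counit y
  counit_one : H.counit H.one = 1
  connected : ∀ x : H.obj PEmpty, H.counit x • H.one = x

/-- A family of subspaces `W[I] ⊆ H[I]` is a Hopf submonoid if it is a subspecies that contains the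
unit, with `W[I] · W[J] ⊆ W[I ⊔ J]` and `Δ_{I,J}(W[I ⊔ J]) ⊆ W[I] ⊗ W[J]`. -/
structure IsHopfSubmonoid {k : Type v} [Field k] (H : HopfMonoidData.{u, v, w} k)
    (W : (I : Type u) → [Finite I] → Submodule k (H.obj I)) : Prop where
  map_mem : ∀ {I J : Type u} [Finite I] [Finite J] (e : I ≃ J), ∀ x ∈ W I, H.map e x ∈ W J
  one_mem : H.one ∈ W PEmpty
  mul_mem : ∀ (I J : Type u) [Finite I] [Finite J], ∀ x ∈ W I, ∀ y ∈ W J,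
    H.mul I J (x ⊗ₜ[k] y) ∈ W (I ⊕ J)
  comul_mem : ∀ (I J : Type u) [Finite I] [Finite J], ∀ x ∈ W (I ⊕ J),
    H.comul I J x ∈ LinearMap.range (TensorProduct.mapIncl (W I) (W J))

/-- The Hadamard product of two Hopf monoids, with componentwise operations. -/
def HopfMonoidData.hadamard {k : Type v} [Field k] (H K : HopfMonoidData.{u, v, w} k) :
    HopfMonoidData.{u, v, w} k where
  obj I := H.obj I ⊗[k] K.obj I
  map e := TensorProduct.map (H.map e) (K.map e)
  mul I J := TensorProduct.map (H.mul I J) (K.mul I J) ∘ₗ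
    (TensorProduct.tensorTensorTensorComm k (H.obj I) (K.obj I) (H.obj J) (K.obj J)).toLinearMap
  comul I J :=
    (TensorProduct.tensorTensorTensorComm k (H.obj I) (H.obj J) (K.obj I) (K.obj J)).toLinearMap ∘ₗ
      TensorProduct.map (H.comul I J) (K.comul I J)
  one := H.one ⊗ₜ[k] K.one
  counit := LinearMap.mul' k k ∘ₗ TensorProduct.map H.counit K.counit

/-- The linear map on `k[X] ⊗ k[Y]` given by its values on the basis `X × Y`. -/
def liftTensor (k : Type v) [Field k] {X Y : Type u} {M : Type w} [AddCommGroup M] [Module k M]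
    (f : X → Y → M) : (X →₀ k) ⊗[k] (Y →₀ k) →ₗ[k] M :=
  TensorProduct.lift (Finsupp.lift ((Y →₀ k) →ₗ[k] M) k X fun x => Finsupp.lift M k Y (f x))

/-- The Hopf monoid `L*` of linear orders, with the shuffle product and with the coproduct
`v ↦ v|I ⊗ v|J` if `v|I` is an initial segment of `v`, and `v ↦ 0` otherwise. -/
def Lstar (k : Type v) [Field k] : HopfMonoidData.{u, v, max u v} k where
  obj I := LinearOrd I →₀ k
  map e := Finsupp.lmapDomain k k (LinearOrd.relabel e)
  mul I J := liftTensor k fun (w : LinearOrd I) (t : LinearOrd J) =>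
    ∑ v ∈ (Set.toFinite (shuffles w t)).toFinset, Finsupp.single v 1
  comul I J := Finsupp.lift _ k (LinearOrd (I ⊕ J)) fun v =>
    open scoped Classical in
    if v.LeftInitial then Finsupp.single v.left 1 ⊗ₜ[k] Finsupp.single v.right 1 else 0
  one := Finsupp.single LinearOrd.empty 1
  counit := Finsupp.lift k k (LinearOrd PEmpty) fun _ => 1

/-- The Hopf monoid `GP₊` of extended generalized permutahedra, with product `p × q` and with the
coproduct `p ↦ p|I ⊗ p/I` if `p` is bounded above in the direction of the indicator vector of `I`,
and `p ↦ 0` otherwise. -/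
def GPplus (k : Type v) [Field k] : HopfMonoidData.{u, v, max u v} k where
  obj I := EGP I →₀ k
  map e := Finsupp.lmapDomain k k (EGP.relabel e)
  mul I J := liftTensor k fun (p : EGP I) (q : EGP J) => Finsupp.single (p.prod q) 1
  comul I J := Finsupp.lift _ k (EGP (I ⊕ J)) fun p =>
    open scoped Classical in
    if h : p.BoundedLeft then Finsupp.single (p.restr h) 1 ⊗ₜ[k] Finsupp.single (p.contr h) 1
    else 0
  one := Finsupp.single EGP.point 1
  counit := Finsupp.lift k k (EGP PEmpty) fun _ => 1

/-! ### Ordered extended generalized permutahedra -/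

/-- The two conventions for the braid chamber of a linear order: coordinates increase, or
decrease, along the order. -/
inductive ChamberConvention
  | increasing
  | decreasing

/-- The braid chamber `σ_w` of a linear order `w`, an open cone. -/
def chamber {I : Type u} : ChamberConvention → LinearOrd I → Set (I → ℝ)
  | .increasing, w => {x | ∀ i j, x i < x j ↔ (w.1 i j ∧ i ≠ j)}
  | .decreasing, w => {x | ∀ i j, x j < x i ↔ (w.1 i j ∧ i ≠ j)}

/-- The braid chamber of `w` is contained in the normal fan of `p`. -/
def Compatible (c : ChamberConvention) {I : Type u} (w : LinearOrd I) (p : EGP I) : Prop :=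
  chamber c w ⊆ ⋃₀ normalFan p.1

/-- The set of all points of `p` that maximize every linear functional in `σ`. -/
def maxFace {I : Type u} (p σ : Set (I → ℝ)) : Set (I → ℝ) :=
  {y | y ∈ p ∧ ∀ x ∈ σ, ∀ z ∈ p, dot x z ≤ dot x y}

/-- The tensor `w ⊗ p`, an element of `(L* × GP₊)[I]`. -/
def tensor (k : Type v) [Field k] {I : Type u} [Finite I] (w : LinearOrd I) (p : EGP I) :
    ((Lstar.{u, v} k).hadamard (GPplus k)).obj I :=
  (Finsupp.single w (1 : k) : LinearOrd I →₀ k) ⊗ₜ[k] (Finsupp.single p (1 : k) : EGP I →₀ k)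

/-- `OGP₊[I]`: the subspace of `(L* × GP₊)[I]` spanned by the tensors `w ⊗ p` such that the braid
chamber of `w` is contained in the normal fan of `p`. -/
def OGPplus (k : Type v) [Field k] (c : ChamberConvention) (I : Type u) [Finite I] :
    Submodule k (((Lstar.{u, v} k).hadamard (GPplus k)).obj I) :=
  Submodule.span k {t | ∃ (w : LinearOrd I) (p : EGP I), Compatible c w p ∧ t = tensor k w p}

end OrderedGP

end

/-!
The axioms of a Hopf monoid are multilinear, so they can be checked on spanning families: on the
linear orders, on the polyhedra and, for a Hadamard product, on pure tensors.

Coassociativity of `GP₊` rests on the fact that for large `C` the face of a polyhedron in direction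
`y + C x` is the `y`-face of its `x`-face. Hence taking the `1_{I ⊔ J}`-face and then the
`1_I`-face, or the `1_I`-face and then the `1_J`-face, gives the face in a direction that decreases
along `I`, `J`, `K`; its three factors are determined because a nonempty product determines its
factors.

That `OGP₊` is closed under the coproduct follows by gluing: when `v|I` is an initial segment of
`v`, points of the chambers of `v|I` and of `v|J` form a point of the chamber of `v` once the second
has been translated along `1_J`, and this translation does not change the faces of `p/I`.

Finally, the chamber `σ_w` is open and lies in a single cone of the normal fan of `p`, so the
functionals in it can be constant on the corresponding face only if that face is a point; being
exposed, this point is a vertex.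
-/

noncomputable section

namespace OrderedGP

section BilinearMaps

variable {k : Type*} [CommSemiring k] {A A' B B' C C' D D' P P' Q Q' R : Type*}
  [AddCommMonoid A] [Module k A] [AddCommMonoid A'] [Module k A'] [AddCommMonoid B] [Module k B]
  [AddCommMonoid B'] [Module k B'] [AddCommMonoid C] [Module k C] [AddCommMonoid C'] [Module k C']
  [AddCommMonoid D] [Module k D] [AddCommMonoid D'] [Module k D'] [AddCommMonoid P] [Module k P]
  [AddCommMonoid P'] [Module k P'] [AddCommMonoid Q] [Module k Q] [AddCommMonoid Q'] [Module k Q']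
  [AddCommMonoid R] [Module k R]

lemma map_map₂ {φ : A →ₗ[k] B →ₗ[k] P} {ψ : C →ₗ[k] D →ₗ[k] Q} {φ' : A' →ₗ[k] B' →ₗ[k] P'}
    {ψ' : C' →ₗ[k] D' →ₗ[k] Q'} {f : P →ₗ[k] P'} {g : Q →ₗ[k] Q'} {a : A →ₗ[k] A'}
    {b : B →ₗ[k] B'} {c : C →ₗ[k] C'} {d : D →ₗ[k] D'}
    (h : ∀ x y, f (φ x y) = φ' (a x) (b y)) (h' : ∀ x y, g (ψ x y) = ψ' (c x) (d y))
    (x : A ⊗[k] C) (y : B ⊗[k] D) :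
    TensorProduct.map f g (TensorProduct.map₂ φ ψ x y) =
      TensorProduct.map₂ φ' ψ' (TensorProduct.map a c x) (TensorProduct.map b d y) := by
  have key : (TensorProduct.map₂ φ ψ).compr₂ (TensorProduct.map f g) =
      (TensorProduct.map₂ φ' ψ').compl₁₂ (TensorProduct.map a c) (TensorProduct.map b d) := by
    ext; simp [h, h']
  exact LinearMap.congr_fun₂ key x y

lemma assoc_map₂ (φ : A →ₗ[k] B →ₗ[k] P) (ψ : A' →ₗ[k] B' →ₗ[k] Q) (χ : C →ₗ[k] D →ₗ[k] R)
    (x : (A ⊗[k] A') ⊗[k] C) (y : (B ⊗[k] B') ⊗[k] D) :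
    TensorProduct.assoc k P Q R (TensorProduct.map₂ (TensorProduct.map₂ φ ψ) χ x y) =
      TensorProduct.map₂ φ (TensorProduct.map₂ ψ χ) (TensorProduct.assoc k A A' C x)
        (TensorProduct.assoc k B B' D y) := by
  have key : (TensorProduct.map₂ (TensorProduct.map₂ φ ψ) χ).compr₂
        (TensorProduct.assoc k P Q R).toLinearMap =
      (TensorProduct.map₂ φ (TensorProduct.map₂ ψ χ)).compl₁₂
        (TensorProduct.assoc k A A' C).toLinearMap
        (TensorProduct.assoc k B B' D).toLinearMap := by
    ext; simp
  exact LinearMap.congr_fun₂ key x y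

lemma tensorTensorTensorComm_map₂ (φ : A →ₗ[k] B →ₗ[k] P) (ψ : A' →ₗ[k] B' →ₗ[k] P')
    (χ : C →ₗ[k] D →ₗ[k] Q) (ω : C' →ₗ[k] D' →ₗ[k] Q') (x : A ⊗[k] A') (y : B ⊗[k] B')
    (z : C ⊗[k] C') (t : D ⊗[k] D') :
    TensorProduct.tensorTensorTensorComm k P P' Q Q'
        (TensorProduct.map₂ φ ψ x y ⊗ₜ TensorProduct.map₂ χ ω z t) =
      TensorProduct.map₂ (TensorProduct.map₂ φ χ) (TensorProduct.map₂ ψ ω)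
        (TensorProduct.tensorTensorTensorComm k A A' C C' (x ⊗ₜ z))
        (TensorProduct.tensorTensorTensorComm k B B' D D' (y ⊗ₜ t)) := by
  have key : (TensorProduct.map₂ (TensorProduct.map₂ φ ψ) (TensorProduct.map₂ χ ω)).compr₂
        (TensorProduct.tensorTensorTensorComm k P P' Q Q').toLinearMap =
      (TensorProduct.map₂ (TensorProduct.map₂ φ χ) (TensorProduct.map₂ ψ ω)).compl₁₂
        (TensorProduct.tensorTensorTensorComm k A A' C C').toLinearMap
        (TensorProduct.tensorTensorTensorComm k B B' D D').toLinearMap := by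
    ext; simp
  exact LinearMap.congr_fun₂ key (x ⊗ₜ z) (y ⊗ₜ t)

lemma lid_map₂ (φ : A →ₗ[k] B →ₗ[k] P) (x : k ⊗[k] A) (y : k ⊗[k] B) :
    TensorProduct.lid k P (TensorProduct.map₂ (LinearMap.mul k k) φ x y) =
      φ (TensorProduct.lid k A x) (TensorProduct.lid k B y) := by
  have key : (TensorProduct.map₂ (LinearMap.mul k k) φ).compr₂
        (TensorProduct.lid k P).toLinearMap =
      φ.compl₁₂ (TensorProduct.lid k A).toLinearMap (TensorProduct.lid k B).toLinearMap := by
    ext; simp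
  exact LinearMap.congr_fun₂ key x y

lemma rid_map₂ (φ : A →ₗ[k] B →ₗ[k] P) (x : A ⊗[k] k) (y : B ⊗[k] k) :
    TensorProduct.rid k P (TensorProduct.map₂ φ (LinearMap.mul k k) x y) =
      φ (TensorProduct.rid k A x) (TensorProduct.rid k B y) := by
  have key : (TensorProduct.map₂ φ (LinearMap.mul k k)).compr₂
        (TensorProduct.rid k P).toLinearMap =
      φ.compl₁₂ (TensorProduct.rid k A).toLinearMap (TensorProduct.rid k B).toLinearMap := by
    ext; simp
  exact LinearMap.congr_fun₂ key x y

lemma tensorTensorTensorComm_eq_map₂_mk (x : A ⊗[k] B) (y : C ⊗[k] D) :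
    TensorProduct.tensorTensorTensorComm k A B C D (x ⊗ₜ y) =
      TensorProduct.map₂ (TensorProduct.mk k A C) (TensorProduct.mk k B D) x y := by
  have key : (TensorProduct.mk k (A ⊗[k] B) (C ⊗[k] D)).compr₂
        (TensorProduct.tensorTensorTensorComm k A B C D).toLinearMap =
      TensorProduct.map₂ (TensorProduct.mk k A C) (TensorProduct.mk k B D) := by
    ext; simp
  exact LinearMap.congr_fun₂ key x y

end BilinearMaps

section Generators

/-- The axioms of a connected Hopf monoid, evaluated at the members `b I x` of families of vectors
in the spaces `H[I]`; they imply `IsHopfMonoid H` once these families are spanning. -/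
structure IsHopfMonoidOn {k : Type v} [Field k] (H : HopfMonoidData.{u, v, w} k)
    {X : (I : Type u) → [Finite I] → Type*} (b : ∀ (I : Type u) [Finite I], X I → H.obj I) :
    Prop where
  map_refl : ∀ {I : Type u} [Finite I] (x : X I), H.map (Equiv.refl I) (b I x) = b I x
  map_trans : ∀ {I J K : Type u} [Finite I] [Finite J] [Finite K] (e : I ≃ J) (f : J ≃ K) (x : X I),
    H.map (e.trans f) (b I x) = H.map f (H.map e (b I x))
  mul_natural : ∀ {I J I' J' : Type u} [Finite I] [Finite J] [Finite I'] [Finite J']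
    (e : I ≃ I') (f : J ≃ J') (x : X I) (y : X J),
    H.map (Equiv.sumCongr e f) (H.mul I J (b I x ⊗ₜ b J y)) =
      H.mul I' J' (H.map e (b I x) ⊗ₜ H.map f (b J y))
  comul_natural : ∀ {I J I' J' : Type u} [Finite I] [Finite J] [Finite I'] [Finite J']
    (e : I ≃ I') (f : J ≃ J') (x : X (I ⊕ J)),
    H.comul I' J' (H.map (Equiv.sumCongr e f) (b (I ⊕ J) x)) =
      TensorProduct.map (H.map e) (H.map f) (H.comul I J (b (I ⊕ J) x))
  mul_assoc : ∀ {I J K : Type u} [Finite I] [Finite J] [Finite K] (x : X I) (y : X J) (z : X K),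
    H.map (Equiv.sumAssoc I J K) (H.mul (I ⊕ J) K (H.mul I J (b I x ⊗ₜ b J y) ⊗ₜ b K z)) =
      H.mul I (J ⊕ K) (b I x ⊗ₜ H.mul J K (b J y ⊗ₜ b K z))
  comul_assoc : ∀ {I J K : Type u} [Finite I] [Finite J] [Finite K] (x : X ((I ⊕ J) ⊕ K)),
    TensorProduct.map LinearMap.id (H.comul J K)
        (H.comul I (J ⊕ K) (H.map (Equiv.sumAssoc I J K) (b ((I ⊕ J) ⊕ K) x))) =
      TensorProduct.assoc k (H.obj I) (H.obj J) (H.obj K)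
        (TensorProduct.map (H.comul I J) LinearMap.id (H.comul (I ⊕ J) K (b ((I ⊕ J) ⊕ K) x)))
  one_mul : ∀ {I : Type u} [Finite I] (x : X I),
    H.map (Equiv.emptySum PEmpty I) (H.mul PEmpty I (H.one ⊗ₜ b I x)) = b I x
  mul_one : ∀ {I : Type u} [Finite I] (x : X I),
    H.map (Equiv.sumEmpty I PEmpty) (H.mul I PEmpty (b I x ⊗ₜ H.one)) = b I x
  counit_comul : ∀ {I : Type u} [Finite I] (x : X I),
    TensorProduct.lid k (H.obj I) (TensorProduct.map H.counit LinearMap.id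
      (H.comul PEmpty I (H.map (Equiv.emptySum PEmpty I).symm (b I x)))) = b I x
  comul_counit : ∀ {I : Type u} [Finite I] (x : X I),
    TensorProduct.rid k (H.obj I) (TensorProduct.map LinearMap.id H.counit
      (H.comul I PEmpty (H.map (Equiv.sumEmpty I PEmpty).symm (b I x)))) = b I x
  comul_mul : ∀ {A B C D : Type u} [Finite A] [Finite B] [Finite C] [Finite D]
    (x : X (A ⊕ B)) (y : X (C ⊕ D)),
    H.comul (A ⊕ C) (B ⊕ D) (H.map (Equiv.sumSumSumComm A B C D)
        (H.mul (A ⊕ B) (C ⊕ D) (b (A ⊕ B) x ⊗ₜ b (C ⊕ D) y))) =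
      TensorProduct.map (H.mul A C) (H.mul B D)
        (TensorProduct.tensorTensorTensorComm k (H.obj A) (H.obj B) (H.obj C) (H.obj D)
          (H.comul A B (b (A ⊕ B) x) ⊗ₜ H.comul C D (b (C ⊕ D) y)))
  comul_one : H.comul PEmpty PEmpty (H.map (Equiv.sumEmpty PEmpty PEmpty).symm H.one) =
    H.one ⊗ₜ H.one
  counit_mul : ∀ x y : X PEmpty,
    H.counit (H.map (Equiv.sumEmpty PEmpty PEmpty)
        (H.mul PEmpty PEmpty (b PEmpty x ⊗ₜ b PEmpty y))) =
      H.counit (b PEmpty x) * H.counit (b PEmpty y)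
  counit_one : H.counit H.one = 1
  connected : ∀ x : X PEmpty, H.counit (b PEmpty x) • H.one = b PEmpty x

lemma tensor_ext_on_range {k M N P X Y : Type*} [CommSemiring k] [AddCommMonoid M] [Module k M]
    [AddCommMonoid N] [Module k N] [AddCommMonoid P] [Module k P] {b : X → M} {c : Y → N}
    (hb : Submodule.span k (Set.range b) = ⊤) (hc : Submodule.span k (Set.range c) = ⊤)
    {f g : M ⊗[k] N →ₗ[k] P} (h : ∀ x y, f (b x ⊗ₜ c y) = g (b x ⊗ₜ c y)) : f = g :=
  TensorProduct.ext <| LinearMap.ext_on_range hb fun x => LinearMap.ext_on_range hc fun y => h x y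

variable {k : Type v} [Field k] {H : HopfMonoidData.{u, v, w} k}

theorem IsHopfMonoidOn.isHopfMonoid {X : (I : Type u) → [Finite I] → Type*}
    {b : ∀ (I : Type u) [Finite I], X I → H.obj I} (h : IsHopfMonoidOn H b)
    (hb : ∀ (I : Type u) [Finite I], Submodule.span k (Set.range (b I)) = ⊤) :
    IsHopfMonoid H where
  map_refl I _ := LinearMap.ext_on_range (hb I) h.map_refl
  map_trans e f := LinearMap.ext_on_range (hb _) (h.map_trans e f)
  mul_natural e f := tensor_ext_on_range (hb _) (hb _) (h.mul_natural e f)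
  comul_natural e f := LinearMap.ext_on_range (hb _) (h.comul_natural e f)
  mul_assoc _ _ _ := TensorProduct.ext <| tensor_ext_on_range (hb _) (hb _) fun x y =>
    LinearMap.ext_on_range (hb _) (h.mul_assoc x y)
  comul_assoc _ _ _ := LinearMap.ext_on_range (hb _) h.comul_assoc
  one_mul I _ := LinearMap.congr_fun (f := H.map (Equiv.emptySum PEmpty I) ∘ₗ H.mul PEmpty I ∘ₗ
    TensorProduct.mk k _ _ H.one) (g := LinearMap.id) (LinearMap.ext_on_range (hb I) h.one_mul)
  mul_one I _ := LinearMap.congr_fun (f := H.map (Equiv.sumEmpty I PEmpty) ∘ₗ H.mul I PEmpty ∘ₗ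
    (TensorProduct.mk k _ _).flip H.one) (g := LinearMap.id)
    (LinearMap.ext_on_range (hb I) h.mul_one)
  counit_comul I _ := LinearMap.congr_fun (f := (TensorProduct.lid k _).toLinearMap ∘ₗ
    TensorProduct.map H.counit LinearMap.id ∘ₗ H.comul PEmpty I ∘ₗ
    H.map (Equiv.emptySum PEmpty I).symm) (g := LinearMap.id)
    (LinearMap.ext_on_range (hb I) h.counit_comul)
  comul_counit I _ := LinearMap.congr_fun (f := (TensorProduct.rid k _).toLinearMap ∘ₗ
    TensorProduct.map LinearMap.id H.counit ∘ₗ H.comul I PEmpty ∘ₗ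
    H.map (Equiv.sumEmpty I PEmpty).symm) (g := LinearMap.id)
    (LinearMap.ext_on_range (hb I) h.comul_counit)
  comul_mul _ _ _ _ := tensor_ext_on_range (hb _) (hb _) h.comul_mul
  comul_one := h.comul_one
  counit_mul x y := LinearMap.congr_fun (f := H.counit ∘ₗ H.map (Equiv.sumEmpty PEmpty PEmpty) ∘ₗ
      H.mul PEmpty PEmpty) (g := LinearMap.mul' k k ∘ₗ TensorProduct.map H.counit H.counit)
    (tensor_ext_on_range (hb _) (hb _) h.counit_mul) (x ⊗ₜ y)
  counit_one := h.counit_one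
  connected := LinearMap.congr_fun (f := H.counit.smulRight H.one) (g := LinearMap.id)
    (LinearMap.ext_on_range (hb _) h.connected)

theorem IsHopfMonoid.isHopfMonoidOn (h : IsHopfMonoid H) {X : (I : Type u) → [Finite I] → Type*}
    (b : ∀ (I : Type u) [Finite I], X I → H.obj I) : IsHopfMonoidOn H b where
  map_refl _ := LinearMap.congr_fun (h.map_refl _) _
  map_trans e f _ := LinearMap.congr_fun (h.map_trans e f) _
  mul_natural e f _ _ := LinearMap.congr_fun (h.mul_natural e f) (_ ⊗ₜ _)
  comul_natural e f _ := LinearMap.congr_fun (h.comul_natural e f) _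
  mul_assoc _ _ _ := LinearMap.congr_fun (h.mul_assoc _ _ _) ((_ ⊗ₜ _) ⊗ₜ _)
  comul_assoc _ := LinearMap.congr_fun (h.comul_assoc _ _ _) _
  one_mul _ := h.one_mul _ _
  mul_one _ := h.mul_one _ _
  counit_comul _ := h.counit_comul _ _
  comul_counit _ := h.comul_counit _ _
  comul_mul _ _ := LinearMap.congr_fun (h.comul_mul _ _ _ _) (_ ⊗ₜ _)
  comul_one := h.comul_one
  counit_mul _ _ := h.counit_mul _ _
  counit_one := h.counit_one
  connected _ := h.connected _

theorem isHopfSubmonoid_span {S : (I : Type u) → [Finite I] → Set (H.obj I)}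
    (map_mem : ∀ {I J : Type u} [Finite I] [Finite J] (e : I ≃ J), ∀ x ∈ S I,
      H.map e x ∈ Submodule.span k (S J))
    (one_mem : H.one ∈ Submodule.span k (S PEmpty))
    (mul_mem : ∀ {I J : Type u} [Finite I] [Finite J], ∀ x ∈ S I, ∀ y ∈ S J,
      H.mul I J (x ⊗ₜ y) ∈ Submodule.span k (S (I ⊕ J)))
    (comul_mem : ∀ {I J : Type u} [Finite I] [Finite J], ∀ x ∈ S (I ⊕ J), H.comul I J x ∈
      LinearMap.range (TensorProduct.mapIncl (Submodule.span k (S I)) (Submodule.span k (S J)))) :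
    IsHopfSubmonoid H fun I _ => Submodule.span k (S I) where
  map_mem {_ J _ _} e :=
    Submodule.span_le (p := (Submodule.span k (S J)).comap (H.map e)).2 (map_mem e)
  one_mem := one_mem
  mul_mem I J _ _ x hx y hy := LinearMap.BilinMap.apply_apply_mem_of_mem_span _ _ _
    (TensorProduct.curry (H.mul I J)) mul_mem x y hx hy
  comul_mem I J _ _ := Submodule.span_le (p := (LinearMap.range (TensorProduct.mapIncl
    (Submodule.span k (S I)) (Submodule.span k (S J)))).comap (H.comul I J)).2 comul_mem

end Generators

section Hadamard

variable {k : Type v} [Field k]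

/-- The pure tensor `a ⊗ b` as an element of the Hadamard product. -/
def HopfMonoidData.tmul (H K : HopfMonoidData.{u, v, w} k) (I : Type u) [Finite I] :
    H.obj I →ₗ[k] K.obj I →ₗ[k] (H.hadamard K).obj I :=
  TensorProduct.mk k (H.obj I) (K.obj I)

variable {H K : HopfMonoidData.{u, v, w} k}

lemma span_range_tmul (I : Type u) [Finite I] :
    Submodule.span k (Set.range fun x : H.obj I × K.obj I => H.tmul K I x.1 x.2) = ⊤ := by
  refine Eq.trans ?_ (TensorProduct.span_tmul_eq_top k (H.obj I) (K.obj I))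
  exact congrArg (Submodule.span k) (Set.ext fun _ => Prod.exists)

lemma hadamard_map {I J : Type u} [Finite I] [Finite J] (e : I ≃ J) (a : H.obj I) (b : K.obj I) :
    (H.hadamard K).map e (H.tmul K I a b) = H.tmul K J (H.map e a) (K.map e b) := rfl

lemma hadamard_mul {I J : Type u} [Finite I] [Finite J] (a : H.obj I) (b : K.obj I) (c : H.obj J)
    (d : K.obj J) :
    (H.hadamard K).mul I J (H.tmul K I a b ⊗ₜ H.tmul K J c d) =
      H.tmul K (I ⊕ J) (H.mul I J (a ⊗ₜ c)) (K.mul I J (b ⊗ₜ d)) := rfl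

lemma hadamard_comul {I J : Type u} [Finite I] [Finite J] (a : H.obj (I ⊕ J))
    (b : K.obj (I ⊕ J)) :
    (H.hadamard K).comul I J (H.tmul K (I ⊕ J) a b) =
      TensorProduct.map₂ (H.tmul K I) (H.tmul K J) (H.comul I J a) (K.comul I J b) :=
  tensorTensorTensorComm_eq_map₂_mk (H.comul I J a) (K.comul I J b)

lemma hadamard_one : (H.hadamard K).one = H.tmul K PEmpty H.one K.one := rfl

lemma hadamard_counit (a : H.obj PEmpty) (b : K.obj PEmpty) :
    (H.hadamard K).counit (H.tmul K PEmpty a b) = H.counit a * K.counit b := rfl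

lemma hadamard_mul_map₂ {I J : Type u} [Finite I] [Finite J] (x : H.obj I ⊗[k] H.obj J)
    (y : K.obj I ⊗[k] K.obj J) :
    (H.hadamard K).mul I J (TensorProduct.map₂ (H.tmul K I) (H.tmul K J) x y) =
      H.tmul K (I ⊕ J) (H.mul I J x) (K.mul I J y) := by
  have key : (TensorProduct.map₂ (H.tmul K I) (H.tmul K J)).compr₂ ((H.hadamard K).mul I J) =
      (H.tmul K (I ⊕ J)).compl₁₂ (H.mul I J) (K.mul I J) :=
    TensorProduct.ext' fun a c => TensorProduct.ext' fun b d => hadamard_mul a b c d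
  exact LinearMap.congr_fun₂ key x y

theorem IsHopfMonoidOn.hadamard {X Y : (I : Type u) → [Finite I] → Type*}
    {b : ∀ (I : Type u) [Finite I], X I → H.obj I} {c : ∀ (I : Type u) [Finite I], Y I → K.obj I}
    (hH : IsHopfMonoidOn H b) (hK : IsHopfMonoidOn K c) :
    IsHopfMonoidOn (H.hadamard K) fun I _ (x : X I × Y I) =>
      H.tmul K I (b I x.1) (c I x.2) where
  map_refl x := by simp only [hadamard_map, hH.map_refl, hK.map_refl]
  map_trans e f x := by
    simp only [hadamard_map, hH.map_trans, hK.map_trans]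
  mul_natural e f x y := by
    simp only [hadamard_map, hadamard_mul, hH.mul_natural, hK.mul_natural]
  comul_natural e f x := by
    rw [hadamard_map, hadamard_comul, hH.comul_natural, hK.comul_natural, hadamard_comul,
      map_map₂ (hadamard_map e) (hadamard_map f)]
  mul_assoc x y z := by
    simp only [hadamard_map, hadamard_mul, hH.mul_assoc, hK.mul_assoc]
  comul_assoc x := by
    rw [hadamard_map, hadamard_comul, hadamard_comul,
      map_map₂ (φ' := H.tmul K _) (a := LinearMap.id) (b := LinearMap.id) (fun _ _ => rfl)
        hadamard_comul, hH.comul_assoc, hK.comul_assoc,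
      map_map₂ (ψ' := H.tmul K _) (c := LinearMap.id) (d := LinearMap.id) hadamard_comul
        (fun _ _ => rfl), assoc_map₂]
  one_mul x := by
    simp only [hadamard_one, hadamard_mul, hadamard_map, hH.one_mul, hK.one_mul]
  mul_one x := by
    simp only [hadamard_one, hadamard_mul, hadamard_map, hH.mul_one, hK.mul_one]
  counit_comul {I _} x := by
    rw [hadamard_map, hadamard_comul, map_map₂ (φ' := LinearMap.mul k k) (ψ' := H.tmul K I)
      (c := LinearMap.id) (d := LinearMap.id) hadamard_counit (fun _ _ => rfl), lid_map₂,
      hH.counit_comul, hK.counit_comul]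
  comul_counit {I _} x := by
    rw [hadamard_map, hadamard_comul, map_map₂ (φ' := H.tmul K I) (ψ' := LinearMap.mul k k)
      (a := LinearMap.id) (b := LinearMap.id) (fun _ _ => rfl) hadamard_counit, rid_map₂,
      hH.comul_counit, hK.comul_counit]
  comul_mul x y := by
    rw [hadamard_mul, hadamard_map, hadamard_comul, hH.comul_mul, hK.comul_mul,
      hadamard_comul, hadamard_comul,
      tensorTensorTensorComm_map₂, map_map₂ hadamard_mul_map₂ hadamard_mul_map₂]
  comul_one := by
    simp only [hadamard_one, hadamard_map, hadamard_comul, hH.comul_one, hK.comul_one,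
      TensorProduct.map₂_apply_tmul, TensorProduct.map_tmul]
  counit_mul x y := by
    simp only [hadamard_mul, hadamard_map, hadamard_counit, hH.counit_mul, hK.counit_mul,
      mul_mul_mul_comm]
  counit_one := by simp only [hadamard_one, hadamard_counit, hH.counit_one, hK.counit_one,
    _root_.mul_one]
  connected x := by
    rw [hadamard_counit, hadamard_one, mul_smul, ← map_smul, ← LinearMap.smul_apply, ← map_smul,
      hH.connected, hK.connected]

theorem IsHopfMonoid.hadamard (hH : IsHopfMonoid H) (hK : IsHopfMonoid K) :
    IsHopfMonoid (H.hadamard K) :=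
  ((hH.isHopfMonoidOn fun _ _ => id).hadamard (hK.isHopfMonoidOn fun _ _ => id)).isHopfMonoid
    span_range_tmul

end Hadamard

section LinearOrders

namespace LinearOrd

variable {I J K I' J' : Type u}

lemma ext_rel {v w : LinearOrd I} (h : ∀ i j, v.1 i j ↔ w.1 i j) : v = w :=
  Subtype.ext (funext₂ fun i j => propext (h i j))

instance [IsEmpty I] : Subsingleton (LinearOrd I) := ⟨fun _ _ => ext_rel fun i => isEmptyElim i⟩

lemma relabel_symm_relabel (e : I ≃ J) (v : LinearOrd J) : (v.relabel e.symm).relabel e = v :=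
  ext_rel fun i j => by simp only [relabel, comap, Function.onFun, Equiv.symm_symm,
    Equiv.apply_symm_apply]

lemma relabel_relabel_symm (e : I ≃ J) (v : LinearOrd I) : (v.relabel e).relabel e.symm = v :=
  relabel_symm_relabel e.symm v

lemma relabel_injective (e : I ≃ J) : Function.Injective (relabel e) :=
  Function.LeftInverse.injective (relabel_relabel_symm e)

lemma LeftInitial.not_rel {v : LinearOrd (I ⊕ J)} (h : v.LeftInitial) (i : I) (j : J) :
    ¬ v.1 (Sum.inr j) (Sum.inl i) := fun h' => Sum.inl_ne_inr (v.2.antisymm _ _ (h i j) h')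

/-- The ordinal sum of two linear orders: the only shuffle of which the first is an initial
segment. -/
def append (w : LinearOrd I) (t : LinearOrd J) : LinearOrd (I ⊕ J) :=
  ⟨Sum.Lex w.1 t.1, by
    have := w.2
    have := t.2
    exact {}⟩

lemma left_append (w : LinearOrd I) (t : LinearOrd J) : (w.append t).left = w :=
  ext_rel fun _ _ => Sum.lex_inl_inl

lemma right_append (w : LinearOrd I) (t : LinearOrd J) : (w.append t).right = t :=
  ext_rel fun _ _ => Sum.lex_inr_inr

lemma leftInitial_append (w : LinearOrd I) (t : LinearOrd J) : (w.append t).LeftInitial :=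
  Sum.Lex.sep

lemma LeftInitial.append_eq {v : LinearOrd (I ⊕ J)} (h : v.LeftInitial) :
    v.left.append v.right = v := by
  refine ext_rel ?_
  rintro (i | i) (j | j)
  · exact Sum.lex_inl_inl
  · exact iff_of_true (Sum.Lex.sep i j) (h i j)
  · exact iff_of_false Sum.lex_inr_inl (h.not_rel j i)
  · exact Sum.lex_inr_inr

lemma LeftInitial.ext {v v' : LinearOrd (I ⊕ J)} (h : v.LeftInitial) (h' : v'.LeftInitial)
    (hl : v.left = v'.left) (hr : v.right = v'.right) : v = v' := by
  rw [← h.append_eq, ← h'.append_eq, hl, hr]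

lemma leftInitial_relabel_sumCongr {e : I ≃ I'} {f : J ≃ J'} {v : LinearOrd (I ⊕ J)} :
    (v.relabel (Equiv.sumCongr e f)).LeftInitial ↔ v.LeftInitial :=
  ⟨fun h i j => by simpa [relabel, comap, Function.onFun] using h (e i) (f j),
    fun h i j => h (e.symm i) (f.symm j)⟩

lemma leftInitial_relabel_sumAssoc {v : LinearOrd ((I ⊕ J) ⊕ K)} :
    ((v.relabel (Equiv.sumAssoc I J K)).LeftInitial ∧
      (v.relabel (Equiv.sumAssoc I J K)).right.LeftInitial) ↔
      v.LeftInitial ∧ v.left.LeftInitial := by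
  constructor
  · rintro ⟨h, h'⟩
    exact ⟨Sum.rec (fun i l => h i (Sum.inr l)) h', fun i j => h i (Sum.inl j)⟩
  · rintro ⟨h, h'⟩
    exact ⟨fun i => Sum.rec (h' i) (h (Sum.inl i)), fun j => h (Sum.inr j)⟩

end LinearOrd

end LinearOrders

section Lstar

lemma liftTensor_single {k : Type v} [Field k] {X Y : Type u} {M : Type w} [AddCommGroup M]
    [Module k M] (f : X → Y → M) (x : X) (y : Y) :
    liftTensor k f (Finsupp.single x 1 ⊗ₜ Finsupp.single y 1) = f x y := by
  simp [liftTensor]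

lemma lift_single_one {k X M : Type*} [Semiring k] [AddCommGroup M] [Module k M] (f : X → M)
    (x : X) : Finsupp.lift M k X f (Finsupp.single x 1) = f x := by
  simp

lemma span_range_single_one (k X : Type*) [Semiring k] :
    Submodule.span k (Set.range fun x : X => Finsupp.single x (1 : k)) = ⊤ := by
  rw [← Finsupp.basisSingleOne.span_eq, Finsupp.coe_basisSingleOne]

namespace Lstar

variable {k : Type v} [Field k] {I J K : Type u} [Finite I] [Finite J] [Finite K]

variable (k) in
/-- The basis element of `L*[I]` given by a linear order. -/
def of (w : LinearOrd I) : (Lstar.{u, v} k).obj I := Finsupp.single w 1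

variable (k) in
/-- The sum in `L*[I]` of a set of linear orders; products of basis elements have this form. -/
def setSum (S : Set (LinearOrd I)) : (Lstar.{u, v} k).obj I :=
  ∑ v ∈ (Set.toFinite S).toFinset, of k v

lemma span_range_of : Submodule.span k (Set.range (of k : LinearOrd I → _)) = ⊤ :=
  span_range_single_one k (LinearOrd I)

lemma map_of (e : I ≃ J) (w : LinearOrd I) :
    (Lstar.{u, v} k).map e (of k w) = of k (w.relabel e) :=
  Finsupp.mapDomain_single

lemma mul_of (w : LinearOrd I) (t : LinearOrd J) :
    (Lstar.{u, v} k).mul I J (of k w ⊗ₜ of k t) = setSum k (shuffles w t) :=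
  liftTensor_single _ w t

lemma comul_of {v : LinearOrd (I ⊕ J)} (h : v.LeftInitial) :
    (Lstar.{u, v} k).comul I J (of k v) = of k v.left ⊗ₜ of k v.right :=
  (lift_single_one _ v).trans (if_pos h)

lemma comul_of_eq_zero {v : LinearOrd (I ⊕ J)} (h : ¬ v.LeftInitial) :
    (Lstar.{u, v} k).comul I J (of k v) = 0 :=
  (lift_single_one _ v).trans (if_neg h)

lemma one_eq : (Lstar.{u, v} k).one = of k LinearOrd.empty := rfl

lemma counit_of (w : LinearOrd PEmpty.{u + 1}) : (Lstar.{u, v} k).counit (of k w) = 1 :=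
  lift_single_one _ w

lemma setSum_singleton (w : LinearOrd I) : setSum k {w} = of k w := by
  simp [setSum]

lemma map_setSum {e : I ≃ J} {S : Set (LinearOrd I)} {T : Set (LinearOrd J)}
    (h : ∀ v, v.relabel e ∈ T ↔ v ∈ S) :
    (Lstar.{u, v} k).map e (setSum k S) = setSum k T := by
  rw [setSum, setSum, map_sum]
  refine Finset.sum_nbij' (LinearOrd.relabel e) (LinearOrd.relabel e.symm) ?_ ?_
    (fun v _ => v.relabel_relabel_symm e) (fun v _ => v.relabel_symm_relabel e)
    (fun v _ => map_of e v)
  · intro v hv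
    simpa only [Set.Finite.mem_toFinset, h] using hv
  · intro v hv
    simpa only [Set.Finite.mem_toFinset, ← h, LinearOrd.relabel_symm_relabel] using hv

lemma mul_setSum (S : Set (LinearOrd I)) (T : Set (LinearOrd J)) :
    (Lstar.{u, v} k).mul I J (setSum k S ⊗ₜ setSum k T) =
      setSum k {v | v.left ∈ S ∧ v.right ∈ T} := by
  simp only [setSum, TensorProduct.sum_tmul, TensorProduct.tmul_sum, map_sum, mul_of]
  rw [Finset.sum_comm, ← Finset.sum_product', Finset.sum_sigma']
  refine Finset.sum_nbij' (fun x => x.2) (fun v => ⟨(v.left, v.right), v⟩) ?_ ?_ ?_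
    (fun _ _ => rfl) (fun _ _ => rfl)
  · rintro ⟨⟨w, t⟩, v⟩ h
    simp only [Finset.mem_sigma, Finset.mem_product, Set.Finite.mem_toFinset, shuffles,
      Set.mem_ofPred_eq] at h ⊢
    obtain ⟨hST, rfl, rfl⟩ := h
    exact hST
  · intro v h
    simpa [shuffles] using h
  · rintro ⟨⟨w, t⟩, v⟩ h
    simp only [Finset.mem_sigma, Set.Finite.mem_toFinset] at h
    obtain ⟨-, rfl, rfl⟩ := h
    rfl

lemma comul_setSum {S : Set (LinearOrd (I ⊕ J))} {T : Set (LinearOrd I)} {U : Set (LinearOrd J)}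
    (h : ∀ v, v.LeftInitial → (v ∈ S ↔ v.left ∈ T ∧ v.right ∈ U)) :
    (Lstar.{u, v} k).comul I J (setSum k S) = setSum k T ⊗ₜ setSum k U := by
  classical
  simp only [setSum, TensorProduct.sum_tmul, TensorProduct.tmul_sum, map_sum]
  rw [Finset.sum_comm, ← Finset.sum_product',
    ← Finset.sum_filter_of_ne (p := LinearOrd.LeftInitial)
      fun v _ hv => not_imp_comm.1 comul_of_eq_zero hv]
  refine Finset.sum_nbij' (fun v => (v.left, v.right)) (fun x => x.1.append x.2) ?_ ?_
    (fun v hv => (Finset.mem_filter.1 hv).2.append_eq)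
    (fun x _ => Prod.ext (x.1.left_append x.2) (x.1.right_append x.2))
    (fun v hv => comul_of (Finset.mem_filter.1 hv).2)
  · intro v hv
    simp only [Finset.mem_filter, Set.Finite.mem_toFinset, Finset.mem_product] at hv ⊢
    exact (h v hv.2).1 hv.1
  · rintro ⟨w, t⟩ hv
    simp only [Finset.mem_filter, Set.Finite.mem_toFinset, Finset.mem_product] at hv ⊢
    have hLI := w.leftInitial_append t
    exact ⟨(h _ hLI).2 (by rwa [w.left_append, w.right_append]), hLI⟩

lemma comul_setSum_eq_zero {S : Set (LinearOrd (I ⊕ J))} (h : ∀ v ∈ S, ¬ v.LeftInitial) :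
    (Lstar.{u, v} k).comul I J (setSum k S) = 0 := by
  rw [setSum, map_sum]
  exact Finset.sum_eq_zero fun v hv => comul_of_eq_zero (h v ((Set.Finite.mem_toFinset _).1 hv))

lemma comul_assoc_of (v : LinearOrd ((I ⊕ J) ⊕ K)) :
    TensorProduct.map LinearMap.id ((Lstar.{u, v} k).comul J K)
        ((Lstar k).comul I (J ⊕ K) (of k (v.relabel (Equiv.sumAssoc I J K)))) =
      TensorProduct.assoc k _ _ _ (TensorProduct.map ((Lstar k).comul I J) LinearMap.id
        ((Lstar k).comul (I ⊕ J) K (of k v))) := by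
  have hiff := v.leftInitial_relabel_sumAssoc
  set v' := v.relabel (Equiv.sumAssoc I J K)
  by_cases h : v.LeftInitial ∧ v.left.LeftInitial
  · obtain ⟨h₁', h₂'⟩ := hiff.2 h
    rw [comul_of h₁', comul_of h.1, TensorProduct.map_tmul, TensorProduct.map_tmul,
      comul_of h₂', comul_of h.2]
    rfl
  · trans 0
    · by_cases h₁ : v'.LeftInitial
      · rw [comul_of h₁, TensorProduct.map_tmul, comul_of_eq_zero fun h₂ => h (hiff.1 ⟨h₁, h₂⟩),
          TensorProduct.tmul_zero]
      · rw [comul_of_eq_zero h₁, map_zero]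
    · by_cases h₁ : v.LeftInitial
      · rw [comul_of h₁, TensorProduct.map_tmul, comul_of_eq_zero fun h₂ => h ⟨h₁, h₂⟩,
          TensorProduct.zero_tmul, map_zero]
      · rw [comul_of_eq_zero h₁, map_zero, map_zero]

open LinearOrd in
lemma comul_mul_of {A B C D : Type u} [Finite A] [Finite B] [Finite C] [Finite D]
    (w : LinearOrd (A ⊕ B)) (t : LinearOrd (C ⊕ D)) :
    (Lstar.{u, v} k).comul (A ⊕ C) (B ⊕ D) ((Lstar k).map (Equiv.sumSumSumComm A B C D)
        ((Lstar k).mul (A ⊕ B) (C ⊕ D) (of k w ⊗ₜ of k t))) =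
      TensorProduct.map ((Lstar k).mul A C) ((Lstar k).mul B D)
        (TensorProduct.tensorTensorTensorComm k _ _ _ _
          ((Lstar k).comul A B (of k w) ⊗ₜ (Lstar k).comul C D (of k t))) := by
  set e := Equiv.sumSumSumComm A B C D
  rw [mul_of, map_setSum (T := {v | v.relabel e.symm ∈ shuffles w t})
    fun v => by rw [Set.mem_ofPred_eq, v.relabel_relabel_symm]]
  by_cases h : w.LeftInitial ∧ t.LeftInitial
  · rw [comul_of h.1, comul_of h.2, TensorProduct.tensorTensorTensorComm_tmul,
      TensorProduct.map_tmul, mul_of, mul_of]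
    refine comul_setSum fun v hv => ⟨?_, ?_⟩
    · rintro ⟨rfl, rfl⟩
      exact ⟨⟨rfl, rfl⟩, ⟨rfl, rfl⟩⟩
    · rintro ⟨⟨hA, hC⟩, ⟨hB, hD⟩⟩
      exact ⟨LeftInitial.ext (fun a b => hv (Sum.inl a) (Sum.inl b)) h.1 hA hB,
        LeftInitial.ext (fun c d => hv (Sum.inr c) (Sum.inr d)) h.2 hC hD⟩
  · rw [comul_setSum_eq_zero]
    · obtain h | h := not_and_or.1 h
      · rw [comul_of_eq_zero h, TensorProduct.zero_tmul, map_zero, map_zero]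
      · rw [comul_of_eq_zero h, TensorProduct.tmul_zero, map_zero, map_zero]
    · rintro v ⟨rfl, rfl⟩ hv
      exact h ⟨fun a b => hv (Sum.inl a) (Sum.inl b), fun c d => hv (Sum.inr c) (Sum.inr d)⟩

end Lstar

open Lstar LinearOrd in
theorem isHopfMonoidOn_Lstar (k : Type v) [Field k] :
    IsHopfMonoidOn (Lstar.{u, v} k) fun I _ => (of k : LinearOrd I → _) where
  map_refl _ := map_of _ _
  map_trans e f w := by
    rw [map_of, map_of, map_of]
    rfl
  mul_natural e f w t := by
    rw [mul_of, map_of, map_of, mul_of]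
    exact map_setSum fun v => and_congr ((relabel_injective e).eq_iff (a := v.left) (b := w))
      ((relabel_injective f).eq_iff (a := v.right) (b := t))
  comul_natural e f v := by
    rw [map_of]
    by_cases h : v.LeftInitial
    · rw [comul_of (leftInitial_relabel_sumCongr.2 h), comul_of h, TensorProduct.map_tmul, map_of,
        map_of]
      rfl
    · rw [comul_of_eq_zero (mt leftInitial_relabel_sumCongr.1 h), comul_of_eq_zero h, map_zero]
  mul_assoc w t x := by
    rw [mul_of, mul_of, ← setSum_singleton x, ← setSum_singleton w, mul_setSum, mul_setSum]
    exact map_setSum fun v => and_assoc.symm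
  comul_assoc v := by rw [map_of, comul_assoc_of]
  one_mul w := by
    rw [one_eq, mul_of, ← setSum_singleton w]
    exact map_setSum fun v => ⟨fun h => ⟨Subsingleton.elim _ _, h⟩, fun h => h.2⟩
  mul_one w := by
    rw [one_eq, mul_of, ← setSum_singleton w]
    exact map_setSum fun v => ⟨fun h => ⟨h, Subsingleton.elim _ _⟩, fun h => h.1⟩
  counit_comul w := by
    rw [map_of, comul_of fun i => i.elim, TensorProduct.map_tmul, counit_of,
      TensorProduct.lid_tmul, one_smul]
    rfl
  comul_counit w := by
    rw [map_of, comul_of fun i j => j.elim, TensorProduct.map_tmul, counit_of,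
      TensorProduct.rid_tmul, one_smul]
    rfl
  comul_mul := comul_mul_of
  comul_one := by
    rw [one_eq, map_of, comul_of fun i => i.elim]
    congr 2
  counit_mul w t := by
    rw [mul_of, map_setSum (T := {LinearOrd.empty}), setSum_singleton, counit_of, counit_of,
      counit_of, _root_.mul_one]
    exact fun v => ⟨fun _ => ⟨Subsingleton.elim _ _, Subsingleton.elim _ _⟩,
      fun _ => Subsingleton.elim _ _⟩
  counit_one := counit_of _
  connected w := by
    rw [counit_of, one_smul, one_eq, Subsingleton.elim LinearOrd.empty w]

theorem isHopfMonoid_Lstar (k : Type v) [Field k] : IsHopfMonoid (Lstar.{u, v} k) :=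
  (isHopfMonoidOn_Lstar k).isHopfMonoid fun _ _ => Lstar.span_range_of

end Lstar

section SetOperations

variable {I J K I' J' A A' B C D : Type u}

lemma restrSet_nonempty {p : Set (I ⊕ J → ℝ)} :
    (restrSet p).Nonempty ↔ (face p (indicatorLeft I J)).Nonempty := Set.image_nonempty

lemma contrSet_nonempty {p : Set (I ⊕ J → ℝ)} :
    (contrSet p).Nonempty ↔ (face p (indicatorLeft I J)).Nonempty := Set.image_nonempty

lemma prodSet_nonempty {p : Set (I → ℝ)} {q : Set (J → ℝ)} :
    (prodSet p q).Nonempty ↔ p.Nonempty ∧ q.Nonempty :=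
  ⟨fun ⟨_, hp, hq⟩ => ⟨⟨_, hp⟩, ⟨_, hq⟩⟩, fun ⟨⟨y, hy⟩, ⟨z, hz⟩⟩ => ⟨Sum.elim y z, hy, hz⟩⟩

lemma prodSet_eq_prodSet_iff {p p' : Set (I → ℝ)} {q q' : Set (J → ℝ)}
    (h : (prodSet p q).Nonempty) : prodSet p q = prodSet p' q' ↔ p = p' ∧ q = q' :=
  (Equiv.sumArrowEquivProdArrow I J ℝ).surjective.preimage_injective.eq_iff.trans <|
    Set.prod_eq_prod_iff_of_nonempty (Set.prod_nonempty_iff.2 (prodSet_nonempty.1 h))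

lemma relabelSet_nonempty {e : I ≃ J} {p : Set (I → ℝ)} :
    (relabelSet e p).Nonempty ↔ p.Nonempty :=
  (e.arrowCongr (Equiv.refl ℝ)).symm.surjective.nonempty_preimage

lemma relabelSet_sumAssoc_prodSet (p : Set (I → ℝ)) (q : Set (J → ℝ)) (r : Set (K → ℝ)) :
    relabelSet (Equiv.sumAssoc I J K) (prodSet (prodSet p q) r) = prodSet p (prodSet q r) :=
  Set.ext fun _ => and_assoc

lemma relabelSet_eq_image (e : I ≃ J) (p : Set (I → ℝ)) :
    relabelSet e p = (fun y => y ∘ e.symm) '' p :=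
  ((e.arrowCongr (Equiv.refl ℝ)).image_eq_preimage_symm p).symm

lemma image_comp_sumMap_prodSet (f : A → I) (g : B → J) (p : Set (I → ℝ))
    (q : Set (J → ℝ)) :
    (fun y : I ⊕ J → ℝ => y ∘ Sum.map f g) '' prodSet p q =
      prodSet ((fun y => y ∘ f) '' p) ((fun y => y ∘ g) '' q) := by
  ext x
  constructor
  · rintro ⟨y, hy, rfl⟩
    exact ⟨⟨_, hy.1, rfl⟩, ⟨_, hy.2, rfl⟩⟩
  · rintro ⟨⟨y, hy, hyx⟩, ⟨z, hz, hzx⟩⟩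
    refine ⟨Sum.elim y z, ⟨hy, hz⟩, ?_⟩
    ext (i | i)
    exacts [congrFun hyx i, congrFun hzx i]

lemma image_comp_relabelSet {e : I ≃ I'} {e₀ : A ≃ A'} {f : A → I} {f' : A' → I'}
    (h : ∀ a, f' (e₀ a) = e (f a)) (p : Set (I → ℝ)) :
    (fun y => y ∘ f') '' relabelSet e p = relabelSet e₀ ((fun y => y ∘ f) '' p) := by
  rw [relabelSet_eq_image, relabelSet_eq_image, Set.image_image, Set.image_image]
  refine Set.image_congr fun y _ => funext fun a => congrArg y ?_
  rw [Equiv.symm_apply_eq, ← h, Equiv.apply_symm_apply]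

lemma face_relabelSet_sumCongr (e : I ≃ I') (f : J ≃ J')
    (p : Set (I ⊕ J → ℝ)) :
    face (relabelSet (Equiv.sumCongr e f) p) (indicatorLeft I' J') =
      relabelSet (Equiv.sumCongr e f) (face p (indicatorLeft I J)) := by
  rw [face_relabelSet]
  congr 2
  ext (i | i) <;> rfl

lemma restrSet_relabelSet_sumCongr (e : I ≃ I') (f : J ≃ J') (p : Set (I ⊕ J → ℝ)) :
    restrSet (relabelSet (Equiv.sumCongr e f) p) = relabelSet e (restrSet p) := by
  rw [restrSet, face_relabelSet_sumCongr]
  exact image_comp_relabelSet (f := Sum.inl) (fun _ => rfl) _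

lemma contrSet_relabelSet_sumCongr (e : I ≃ I') (f : J ≃ J') (p : Set (I ⊕ J → ℝ)) :
    contrSet (relabelSet (Equiv.sumCongr e f) p) = relabelSet f (contrSet p) := by
  rw [contrSet, face_relabelSet_sumCongr]
  exact image_comp_relabelSet (f := Sum.inr) (fun _ => rfl) _

variable [Finite A] [Finite B] [Finite C] [Finite D]

lemma face_relabelSet_sumSumSumComm (p : Set (A ⊕ B → ℝ)) (q : Set (C ⊕ D → ℝ)) :
    face (relabelSet (Equiv.sumSumSumComm A B C D) (prodSet p q))
        (indicatorLeft (A ⊕ C) (B ⊕ D)) =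
      relabelSet (Equiv.sumSumSumComm A B C D)
        (prodSet (face p (indicatorLeft A B)) (face q (indicatorLeft C D))) := by
  rw [face_relabelSet, face_prodSet]
  congr 3 <;> ext (i | i) <;> rfl

lemma restrSet_relabelSet_sumSumSumComm (p : Set (A ⊕ B → ℝ)) (q : Set (C ⊕ D → ℝ)) :
    restrSet (relabelSet (Equiv.sumSumSumComm A B C D) (prodSet p q)) =
      prodSet (restrSet p) (restrSet q) := by
  rw [restrSet, face_relabelSet_sumSumSumComm, relabelSet_eq_image, Set.image_image, restrSet,
    restrSet, ← image_comp_sumMap_prodSet]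
  refine Set.image_congr fun y _ => ?_
  ext (i | i) <;> rfl

lemma contrSet_relabelSet_sumSumSumComm (p : Set (A ⊕ B → ℝ)) (q : Set (C ⊕ D → ℝ)) :
    contrSet (relabelSet (Equiv.sumSumSumComm A B C D) (prodSet p q)) =
      prodSet (contrSet p) (contrSet q) := by
  rw [contrSet, face_relabelSet_sumSumSumComm, relabelSet_eq_image, Set.image_image, contrSet,
    contrSet, ← image_comp_sumMap_prodSet]
  refine Set.image_congr fun y _ => ?_
  ext (i | i) <;> rfl

end SetOperations

section Faces

open Filter

variable {I J K : Type u}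

lemma mem_braidFace_symm {x y : I → ℝ} (h : y ∈ braidFace x) : x ∈ braidFace y :=
  fun i j => (h i j).symm

lemma face_zero (p : Set (I → ℝ)) : face p 0 = p := by
  simp [face, zero_dot]

lemma IsEGP.face_eq_of_mem_braidFace {p : Set (I → ℝ)} (hp : IsEGP p) {x y : I → ℝ}
    (h : y ∈ braidFace x) : face p y = face p x := by
  obtain hx | hx := (face p x).eq_empty_or_nonempty
  · obtain hy | hy := (face p y).eq_empty_or_nonempty
    · rw [hx, hy]
    · exact (hp.face_eq (mem_braidFace_symm h) hy).symm
  · exact hp.face_eq h hx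

lemma IsEGP.face_eq_self {p : Set (I → ℝ)} (hp : IsEGP p) {x : I → ℝ} (hx : ∀ i j, x i = x j) :
    face p x = p := by
  rw [hp.face_eq_of_mem_braidFace (x := 0) fun i j => by simp [hx i j], face_zero]

variable [Finite I] [Finite J] [Finite K]

lemma IsPolyhedron.face_nonempty_of_frequently {p : Set (I → ℝ)} (hp : IsPolyhedron p)
    (hne : p.Nonempty) {x y : I → ℝ}
    (h : ∃ᶠ C : ℝ in atTop, (OrderedGP.face p (y + C • x)).Nonempty) :
    (OrderedGP.face p x).Nonempty := by
  obtain ⟨R, hR⟩ := exists_recession hp hne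
  refine (hR x).2 fun z hz => ?_
  by_contra! hpos
  have hlim : Tendsto (fun C : ℝ => dot y z + C * dot x z) atTop atTop :=
    tendsto_atTop_add_const_left _ _ (tendsto_id.atTop_mul_const hpos)
  obtain ⟨C, hC, hC'⟩ := (h.and_eventually (hlim.eventually_gt_atTop 0)).exists
  have := (hR _).1 hC z hz
  rw [add_dot, smul_dot] at this
  exact hC'.not_ge this

lemma IsPolyhedron.face_face_nonempty_of_frequently {p : Set (I → ℝ)} (hp : IsPolyhedron p)
    (hne : p.Nonempty) {x y : I → ℝ}
    (h : ∃ᶠ C : ℝ in atTop, (OrderedGP.face p (y + C • x)).Nonempty) :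
    (OrderedGP.face (OrderedGP.face p x) y).Nonempty := by
  have hx := hp.face_nonempty_of_frequently hne h
  obtain ⟨s, hs⟩ := id hx
  obtain ⟨C, t, ht⟩ := h.exists
  refine face_nonempty_of_le (hp.face x hx) hx y (dot (y + C • x) t - C * dot x s) fun z hz => ?_
  have hzs : dot x z = dot x s := le_antisymm (hs.2 z hz.1) (hz.2 s hs.1)
  have hzt := ht.2 z hz.1
  rw [add_dot y _ z, smul_dot, hzs] at hzt
  linarith

theorem IsEGP.face_face_eq_of_eventually {p : Set (I → ℝ)} (hp : IsEGP p) {x y z : I → ℝ}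
    (h : ∀ᶠ C : ℝ in atTop, y + C • x ∈ braidFace z) : face (face p x) y = face p z := by
  have hz : ∀ᶠ C : ℝ in atTop, face p (y + C • x) = face p z :=
    h.mono fun C hC => hp.face_eq_of_mem_braidFace hC
  by_cases hne : (face (face p x) y).Nonempty
  · obtain ⟨C₀, hC₀⟩ := face_face hp.1 x y hne
    obtain ⟨C, hC, hCz⟩ := ((eventually_gt_atTop C₀).and hz).exists
    rw [← hC₀ C hC, hCz]
  · have hz' : ¬ (face p z).Nonempty := fun hz' => hne <|
      hp.1.face_face_nonempty_of_frequently hp.2.1 (hz.mono fun C hC => by rwa [hC]).frequently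
    rw [Set.not_nonempty_iff_eq_empty.1 hne, Set.not_nonempty_iff_eq_empty.1 hz']

end Faces

section Coassociativity

variable {I J K : Type u} [Finite I] [Finite J] [Finite K] {p : Set ((I ⊕ J) ⊕ K → ℝ)}

lemma IsEGP.face_face_sumAssoc (hp : IsEGP p) :
    relabelSet (Equiv.sumAssoc I J K)
        (face (face p (indicatorLeft (I ⊕ J) K)) (Sum.elim (indicatorLeft I J) 0)) =
      face (face (relabelSet (Equiv.sumAssoc I J K) p) (indicatorLeft I (J ⊕ K)))
        (Sum.elim 0 (indicatorLeft J K)) := by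
  -- Both double faces are the face in any direction that is constant on `I`, `J` and `K` with
  -- values decreasing in this order, such as `(2, 1, 0)`.
  have hleft : face (face p (indicatorLeft (I ⊕ J) K)) (Sum.elim (indicatorLeft I J) 0) =
      face p (Sum.elim (Sum.elim 2 1) 0) := by
    refine hp.face_face_eq_of_eventually ((Filter.eventually_gt_atTop 0).mono fun C hC => ?_)
    rintro ((i | i) | i) ((j | j) | j) <;> simp [indicatorLeft] <;> grind
  have hright : face (face (relabelSet (Equiv.sumAssoc I J K) p) (indicatorLeft I (J ⊕ K)))
      (Sum.elim 0 (indicatorLeft J K)) =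
        face (relabelSet (Equiv.sumAssoc I J K) p) (Sum.elim 2 (Sum.elim 1 0)) := by
    refine (hp.relabel _).face_face_eq_of_eventually
      ((Filter.eventually_gt_atTop 1).mono fun C hC => ?_)
    rintro (i | i | i) (j | j | j) <;> simp [indicatorLeft] <;> grind
  rw [hleft, hright, face_relabelSet]
  congr 2
  ext ((i | i) | i) <;> rfl

theorem IsEGP.relabelSet_sumAssoc_prodSet_restrSet (hp : IsEGP p) :
    relabelSet (Equiv.sumAssoc I J K)
        (prodSet (face (restrSet p) (indicatorLeft I J)) (contrSet p)) =
      prodSet (restrSet (relabelSet (Equiv.sumAssoc I J K) p))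
        (face (contrSet (relabelSet (Equiv.sumAssoc I J K) p)) (indicatorLeft J K)) := by
  have h := hp.face_face_sumAssoc
  rwa [hp.face_eq_prodSet, (hp.relabel _).face_eq_prodSet, face_prodSet, face_prodSet,
    Sum.elim_comp_inl, Sum.elim_comp_inr, Sum.elim_comp_inl, Sum.elim_comp_inr, face_zero,
    face_zero] at h

end Coassociativity

section GPplus

namespace EGP

section

variable {I J I' J' : Type u}

instance [IsEmpty I] : Subsingleton (EGP I) :=
  ⟨fun p q => Subtype.ext ((Subsingleton.eq_univ_of_nonempty p.2.2.1).trans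
    (Subsingleton.eq_univ_of_nonempty q.2.2.1).symm)⟩

lemma boundedLeft_of_forall_eq {p : EGP (I ⊕ J)}
    (h : ∀ i j, indicatorLeft I J i = indicatorLeft I J j) : p.BoundedLeft := by
  rw [BoundedLeft, p.2.face_eq_self h]
  exact p.2.2.1

variable [Finite I] [Finite J] [Finite I'] [Finite J']

lemma boundedLeft_relabel_sumCongr {e : I ≃ I'} {f : J ≃ J'} {p : EGP (I ⊕ J)} :
    (p.relabel (Equiv.sumCongr e f)).BoundedLeft ↔ p.BoundedLeft := by
  rw [BoundedLeft, EGP.relabel, face_relabelSet_sumCongr, relabelSet_nonempty, BoundedLeft]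

lemma boundedLeft_relabel_sumSumSumComm {p : EGP (I ⊕ J)} {q : EGP (I' ⊕ J')} :
    ((p.prod q).relabel (Equiv.sumSumSumComm I J I' J')).BoundedLeft ↔
      p.BoundedLeft ∧ q.BoundedLeft := by
  rw [BoundedLeft, EGP.relabel, EGP.prod, face_relabelSet_sumSumSumComm, relabelSet_nonempty,
    prodSet_nonempty, BoundedLeft, BoundedLeft]

lemma contr_relabel_emptySum (p : EGP I)
    (h : (p.relabel (Equiv.emptySum PEmpty.{u + 1} I).symm).BoundedLeft) :
    (p.relabel (Equiv.emptySum PEmpty I).symm).contr h = p := by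
  refine Subtype.ext ?_
  change contrSet (relabelSet _ p.1) = p.1
  rw [contrSet, (p.2.relabel _).face_eq_self (by rintro (⟨⟨⟩⟩ | _) (⟨⟨⟩⟩ | _); rfl),
    relabelSet_eq_image, Set.image_image]
  exact Set.image_id p.1

lemma restr_relabel_sumEmpty (p : EGP I)
    (h : (p.relabel (Equiv.sumEmpty I PEmpty.{u + 1}).symm).BoundedLeft) :
    (p.relabel (Equiv.sumEmpty I PEmpty).symm).restr h = p := by
  refine Subtype.ext ?_
  change restrSet (relabelSet _ p.1) = p.1
  rw [restrSet, (p.2.relabel _).face_eq_self (by rintro (_ | ⟨⟨⟩⟩) (_ | ⟨⟨⟩⟩); rfl),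
    relabelSet_eq_image, Set.image_image]
  exact Set.image_id p.1

end

section

variable {I J K : Type u} [Finite I] [Finite J] [Finite K] {p : EGP ((I ⊕ J) ⊕ K)}

lemma boundedLeft_relabel_sumAssoc :
    (∃ h : (p.relabel (Equiv.sumAssoc I J K)).BoundedLeft,
      ((p.relabel (Equiv.sumAssoc I J K)).contr h).BoundedLeft) ↔
      ∃ h : p.BoundedLeft, (p.restr h).BoundedLeft := by
  have hne := congrArg Set.Nonempty p.2.relabelSet_sumAssoc_prodSet_restrSet
  rw [relabelSet_nonempty, prodSet_nonempty, prodSet_nonempty, contrSet_nonempty,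
    restrSet_nonempty, and_comm] at hne
  exact ⟨fun ⟨h, h'⟩ => ⟨(hne.mpr ⟨h, h'⟩).1, (hne.mpr ⟨h, h'⟩).2⟩,
    fun ⟨h, h'⟩ => ⟨(hne.mp ⟨h, h'⟩).1, (hne.mp ⟨h, h'⟩).2⟩⟩

lemma restr_contr_relabel_sumAssoc (h : p.BoundedLeft) (hr : (p.restr h).BoundedLeft)
    (h' : (p.relabel (Equiv.sumAssoc I J K)).BoundedLeft)
    (hc : ((p.relabel (Equiv.sumAssoc I J K)).contr h').BoundedLeft) :
    (p.relabel (Equiv.sumAssoc I J K)).restr h' = (p.restr h).restr hr ∧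
      ((p.relabel (Equiv.sumAssoc I J K)).contr h').restr hc = (p.restr h).contr hr ∧
      ((p.relabel (Equiv.sumAssoc I J K)).contr h').contr hc = p.contr h := by
  have heq := p.2.relabelSet_sumAssoc_prodSet_restrSet
  rw [(p.2.restr h).face_eq_prodSet, ((p.2.relabel _).contr h').face_eq_prodSet,
    relabelSet_sumAssoc_prodSet, eq_comm] at heq
  have hne := prodSet_nonempty.2 ⟨restrSet_nonempty.2 h',
    prodSet_nonempty.2 ⟨restrSet_nonempty.2 hc, contrSet_nonempty.2 hc⟩⟩
  obtain ⟨hI, hJK⟩ := (prodSet_eq_prodSet_iff hne).1 heq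
  obtain ⟨hJ, hK⟩ := (prodSet_eq_prodSet_iff (prodSet_nonempty.1 hne).2).1 hJK
  exact ⟨Subtype.ext hI, Subtype.ext hJ, Subtype.ext hK⟩

end

end EGP

namespace GPplus

variable {k : Type v} [Field k] {I J K : Type u} [Finite I] [Finite J] [Finite K]

variable (k) in
/-- The basis element of `GP₊[I]` given by an extended generalized permutahedron. -/
def of (p : EGP I) : (GPplus.{u, v} k).obj I := Finsupp.single p 1

lemma span_range_of : Submodule.span k (Set.range (of k : EGP I → _)) = ⊤ :=
  span_range_single_one k (EGP I)

lemma map_of (e : I ≃ J) (p : EGP I) :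
    (GPplus.{u, v} k).map e (of k p) = of k (p.relabel e) :=
  Finsupp.mapDomain_single

lemma mul_of (p : EGP I) (q : EGP J) :
    (GPplus.{u, v} k).mul I J (of k p ⊗ₜ of k q) = of k (p.prod q) :=
  liftTensor_single _ p q

lemma comul_of {p : EGP (I ⊕ J)} (h : p.BoundedLeft) :
    (GPplus.{u, v} k).comul I J (of k p) = of k (p.restr h) ⊗ₜ of k (p.contr h) :=
  (lift_single_one _ p).trans (dif_pos h)

lemma comul_of_eq_zero {p : EGP (I ⊕ J)} (h : ¬ p.BoundedLeft) :
    (GPplus.{u, v} k).comul I J (of k p) = 0 :=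
  (lift_single_one _ p).trans (dif_neg h)

lemma one_eq : (GPplus.{u, v} k).one = of k EGP.point := rfl

lemma counit_of (p : EGP PEmpty.{u + 1}) : (GPplus.{u, v} k).counit (of k p) = 1 :=
  lift_single_one _ p

lemma comul_assoc_of (p : EGP ((I ⊕ J) ⊕ K)) :
    TensorProduct.map LinearMap.id ((GPplus.{u, v} k).comul J K)
        ((GPplus k).comul I (J ⊕ K) (of k (p.relabel (Equiv.sumAssoc I J K)))) =
      TensorProduct.assoc k _ _ _ (TensorProduct.map ((GPplus k).comul I J) LinearMap.id
        ((GPplus k).comul (I ⊕ J) K (of k p))) := by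
  have hiff := EGP.boundedLeft_relabel_sumAssoc (p := p)
  by_cases hp : ∃ h : p.BoundedLeft, (p.restr h).BoundedLeft
  · obtain ⟨h', hc⟩ := hiff.2 hp
    obtain ⟨h, hr⟩ := hp
    obtain ⟨hI, hJ, hK⟩ := EGP.restr_contr_relabel_sumAssoc h hr h' hc
    rw [comul_of h, comul_of h', TensorProduct.map_tmul, TensorProduct.map_tmul,
      comul_of hr, comul_of hc, TensorProduct.assoc_tmul, hI, hJ, hK]
    rfl
  · trans 0
    · by_cases h' : (p.relabel (Equiv.sumAssoc I J K)).BoundedLeft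
      · rw [comul_of h', TensorProduct.map_tmul, comul_of_eq_zero fun hc => hp (hiff.1 ⟨h', hc⟩),
          TensorProduct.tmul_zero]
      · rw [comul_of_eq_zero h', map_zero]
    · by_cases h : p.BoundedLeft
      · rw [comul_of h, TensorProduct.map_tmul, comul_of_eq_zero fun hr => hp ⟨h, hr⟩,
          TensorProduct.zero_tmul, map_zero]
      · rw [comul_of_eq_zero h, map_zero, map_zero]

lemma comul_mul_of {A B C D : Type u} [Finite A] [Finite B] [Finite C] [Finite D]
    (p : EGP (A ⊕ B)) (q : EGP (C ⊕ D)) :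
    (GPplus.{u, v} k).comul (A ⊕ C) (B ⊕ D) ((GPplus k).map (Equiv.sumSumSumComm A B C D)
        ((GPplus k).mul (A ⊕ B) (C ⊕ D) (of k p ⊗ₜ of k q))) =
      TensorProduct.map ((GPplus k).mul A C) ((GPplus k).mul B D)
        (TensorProduct.tensorTensorTensorComm k _ _ _ _
          ((GPplus k).comul A B (of k p) ⊗ₜ (GPplus k).comul C D (of k q))) := by
  have hiff := EGP.boundedLeft_relabel_sumSumSumComm (p := p) (q := q)
  rw [mul_of, map_of]
  by_cases h : p.BoundedLeft ∧ q.BoundedLeft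
  · rw [comul_of (hiff.2 h), comul_of h.1, comul_of h.2,
      TensorProduct.tensorTensorTensorComm_tmul, TensorProduct.map_tmul, mul_of, mul_of]
    congr 2
    · exact Subtype.ext (restrSet_relabelSet_sumSumSumComm p.1 q.1)
    · exact Subtype.ext (contrSet_relabelSet_sumSumSumComm p.1 q.1)
  · rw [comul_of_eq_zero (mt hiff.1 h)]
    obtain h | h := not_and_or.1 h
    · rw [comul_of_eq_zero h, TensorProduct.zero_tmul, map_zero, map_zero]
    · rw [comul_of_eq_zero h, TensorProduct.tmul_zero, map_zero, map_zero]

end GPplus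

open GPplus EGP in
theorem isHopfMonoidOn_GPplus (k : Type v) [Field k] :
    IsHopfMonoidOn (GPplus.{u, v} k) fun I _ => (of k : EGP I → _) where
  map_refl _ := map_of _ _
  map_trans e f p := by
    rw [map_of, map_of, map_of]
    rfl
  mul_natural e f p q := by
    rw [mul_of, map_of, map_of, map_of, mul_of]
    rfl
  comul_natural e f p := by
    rw [map_of]
    by_cases h : p.BoundedLeft
    · rw [comul_of (boundedLeft_relabel_sumCongr.2 h), comul_of h, TensorProduct.map_tmul, map_of,
        map_of]
      congr 2
      · exact Subtype.ext (restrSet_relabelSet_sumCongr e f p.1)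
      · exact Subtype.ext (contrSet_relabelSet_sumCongr e f p.1)
    · rw [comul_of_eq_zero (mt boundedLeft_relabel_sumCongr.1 h), comul_of_eq_zero h, map_zero]
  mul_assoc p q r := by
    rw [mul_of, mul_of, mul_of, mul_of, map_of]
    exact congrArg (of k) (Subtype.ext (relabelSet_sumAssoc_prodSet p.1 q.1 r.1))
  comul_assoc p := by rw [map_of, comul_assoc_of]
  one_mul p := by
    rw [one_eq, mul_of, map_of]
    exact congrArg (of k) (Subtype.ext (Set.univ_inter p.1))
  mul_one p := by
    rw [one_eq, mul_of, map_of]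
    exact congrArg (of k) (Subtype.ext (Set.inter_univ p.1))
  counit_comul p := by
    rw [map_of, comul_of (boundedLeft_of_forall_eq (by rintro (⟨⟨⟩⟩ | _) (⟨⟨⟩⟩ | _); rfl)),
      TensorProduct.map_tmul, counit_of, TensorProduct.lid_tmul, one_smul, contr_relabel_emptySum]
    rfl
  comul_counit p := by
    rw [map_of, comul_of (boundedLeft_of_forall_eq (by rintro (_ | ⟨⟨⟩⟩) (_ | ⟨⟨⟩⟩); rfl)),
      TensorProduct.map_tmul, counit_of, TensorProduct.rid_tmul, one_smul, restr_relabel_sumEmpty]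
    rfl
  comul_mul := comul_mul_of
  comul_one := by
    rw [one_eq, map_of, comul_of (boundedLeft_of_forall_eq isEmptyElim)]
    congr 2 <;> exact Subsingleton.elim _ _
  counit_mul p q := by
    rw [mul_of, map_of, counit_of, counit_of, counit_of, _root_.mul_one]
  counit_one := counit_of _
  connected p := by
    rw [counit_of, one_smul, one_eq, Subsingleton.elim EGP.point p]

theorem isHopfMonoid_GPplus (k : Type v) [Field k] : IsHopfMonoid (GPplus.{u, v} k) :=
  (isHopfMonoidOn_GPplus k).isHopfMonoid fun _ _ => GPplus.span_range_of

end GPplus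

section Chambers

variable {I J : Type u} {c : ChamberConvention}

lemma mem_chamber_decreasing {w : LinearOrd I} {x : I → ℝ} :
    x ∈ chamber .decreasing w ↔ -x ∈ chamber .increasing w := by
  simp [chamber]

lemma mem_chamber_increasing {w : LinearOrd I} {x : I → ℝ} :
    x ∈ chamber .increasing w ↔ ∀ i j, w.1 i j → i ≠ j → x i < x j := by
  refine ⟨fun h i j hij hne => (h i j).2 ⟨hij, hne⟩,
    fun h i j => ⟨fun hx => ?_, fun ⟨hij, hne⟩ => h i j hij hne⟩⟩
  have hne : i ≠ j := fun hij => hx.ne (congrArg x hij)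
  exact ⟨(w.2.total i j).resolve_right fun hji => lt_asymm hx (h j i hji hne.symm), hne⟩

lemma mem_braidFace_of_mem_chamber {w : LinearOrd I} {x y : I → ℝ} (hx : x ∈ chamber c w)
    (hy : y ∈ chamber c w) : y ∈ braidFace x := by
  cases c
  · exact fun i j => (hy i j).trans (hx i j).symm
  · exact fun i j => (hy j i).trans (hx j i).symm

lemma chamber_nonempty [Finite I] (c : ChamberConvention) (w : LinearOrd I) :
    (chamber c w).Nonempty := by
  have hinc : (fun i => (({j | w.1 j i} : Set I).ncard : ℝ)) ∈ chamber .increasing w := by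
    refine mem_chamber_increasing.2 fun i j hij hne => Nat.cast_lt.2 (Set.ncard_lt_ncard ?_)
    exact ⟨fun l hl => w.2.trans l i j hl hij,
      fun h => hne (w.2.antisymm i j hij (h (w.2.refl j)))⟩
  cases c
  · exact ⟨_, hinc⟩
  · exact ⟨_, mem_chamber_decreasing.2 (Set.mem_of_eq_of_mem (neg_neg _) hinc)⟩

lemma isOpen_chamber [Finite I] (c : ChamberConvention) (w : LinearOrd I) :
    IsOpen (chamber c w) := by
  have hinc : IsOpen (chamber .increasing w) := by
    have heq : chamber .increasing w = {x | ∀ i j, w.1 i j → i ≠ j → x i < x j} :=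
      Set.ext fun _ => mem_chamber_increasing
    simp only [heq, Set.ofPred_forall]
    exact isOpen_iInter_of_finite fun i => isOpen_iInter_of_finite fun j =>
      isOpen_iInter_of_finite fun _ => isOpen_iInter_of_finite fun _ =>
        isOpen_lt (continuous_apply i) (continuous_apply j)
  cases c
  · exact hinc
  · have : chamber .decreasing w = Neg.neg ⁻¹' chamber .increasing w :=
      Set.ext fun x => mem_chamber_decreasing
    rw [this]
    exact hinc.preimage continuous_neg

lemma comp_mem_chamber {f : J → I} (hf : Function.Injective f) {w : LinearOrd I} {x : I → ℝ}
    (hx : x ∈ chamber c w) : x ∘ f ∈ chamber c (w.comap f hf) := by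
  cases c <;> exact fun i j => (hx _ _).trans (and_congr_right fun _ => hf.ne_iff)

variable [Finite I] [Finite J] {v : LinearOrd (I ⊕ J)} {x : I → ℝ} {y : J → ℝ}

lemma exists_elim_add_mem_chamber_increasing (hv : v.LeftInitial)
    (hx : x ∈ chamber .increasing v.left) (hy : y ∈ chamber .increasing v.right) :
    ∃ C : ℝ, Sum.elim x (fun j => y j + C) ∈ chamber .increasing v := by
  obtain ⟨C, hC⟩ := (Set.finite_range fun t : I × J => x t.1 - y t.2).bddAbove
  have hxy (i : I) (j : J) : x i - y j ≤ C := hC ⟨(i, j), rfl⟩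
  refine ⟨C + 1, mem_chamber_increasing.2 ?_⟩
  rintro (i | i) (j | j) hij hne
  · exact mem_chamber_increasing.1 hx i j hij fun h => hne (congrArg Sum.inl h)
  · simp only [Sum.elim_inl, Sum.elim_inr]
    linarith [hxy i j]
  · exact absurd hij (hv.not_rel j i)
  · exact add_lt_add_left
      (mem_chamber_increasing.1 hy i j hij fun h => hne (congrArg Sum.inr h)) _

lemma exists_elim_add_mem_chamber (hv : v.LeftInitial) (hx : x ∈ chamber c v.left)
    (hy : y ∈ chamber c v.right) : ∃ C : ℝ, Sum.elim x (fun j => y j + C) ∈ chamber c v := by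
  cases c
  · exact exists_elim_add_mem_chamber_increasing hv hx hy
  · obtain ⟨C, hC⟩ := exists_elim_add_mem_chamber_increasing hv (mem_chamber_decreasing.1 hx)
      (mem_chamber_decreasing.1 hy)
    refine ⟨-C, mem_chamber_decreasing.2 ?_⟩
    convert hC using 1
    ext (i | j) <;> simp [add_comm]

end Chambers

section Vertices

variable {I : Type u} [Finite I]

lemma eq_zero_of_dot_self {x : I → ℝ} (h : dot x x = 0) : x = 0 := by
  cases nonempty_fintype I
  rw [dot, finsum_eq_sum_of_fintype] at h
  exact dotProduct_self_eq_zero.1 h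

lemma maxFace_subsingleton (p : Set (I → ℝ)) {σ : Set (I → ℝ)} (hσ : IsOpen σ)
    (hne : σ.Nonempty) : (maxFace p σ).Subsingleton := by
  intro y hy z hz
  obtain ⟨x, hx⟩ := hne
  have hdot : ∀ x ∈ σ, dot x (y - z) = 0 := fun x hx => by
    have heq : dot x y = dot x z := le_antisymm (hz.2 x hx y hy.1) (hy.2 x hx z hz.1)
    rw [← sub_eq_zero] at heq
    exact (map_sub (dotLin x) y z).trans heq
  -- `x + ε • (y - z)` stays in `σ` for small `ε`, and is then also orthogonal to `y - z`.
  have hcont : Continuous fun ε : ℝ => x + ε • (y - z) := by fun_prop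
  have hmem : ∀ᶠ ε : ℝ in nhds 0, x + ε • (y - z) ∈ σ :=
    hcont.continuousAt.eventually_mem (hσ.mem_nhds (by simpa using hx))
  obtain ⟨ε, hε, hpos⟩ := ((hmem.filter_mono nhdsWithin_le_nhds).and
    (self_mem_nhdsWithin (s := Set.Ioi (0 : ℝ)))).exists
  have hε0 := hdot _ hε
  rw [add_dot, smul_dot, hdot x hx, zero_add] at hε0
  exact sub_eq_zero.1 (eq_zero_of_dot_self ((mul_eq_zero.1 hε0).resolve_left (ne_of_gt hpos)))

lemma isExposed_face (p : Set (I → ℝ)) (x : I → ℝ) : IsExposed ℝ p (face p x) := fun _ =>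
  ⟨LinearMap.toContinuousLinearMap (dotLin x), rfl⟩

end Vertices

section Compatible

variable {I J : Type u} {c : ChamberConvention}

lemma compatible_iff {w : LinearOrd I} {p : EGP I} :
    Compatible c w p ↔ ∀ x ∈ chamber c w, (face p.1 x).Nonempty :=
  forall₂_congr fun _ _ => mem_sUnion_normalFan

lemma maxFace_chamber {w : LinearOrd I} (p : EGP I) {x : I → ℝ} (hx : x ∈ chamber c w) :
    maxFace p.1 (chamber c w) = face p.1 x := by
  refine Set.Subset.antisymm (fun y hy => ⟨hy.1, hy.2 x hx⟩) fun y hy => ⟨hy.1, fun x' hx' => ?_⟩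
  rw [← p.2.face_eq_of_mem_braidFace (mem_braidFace_of_mem_chamber hx hx')] at hy
  exact hy.2

variable [Finite I] [Finite J]

lemma Compatible.relabel {w : LinearOrd I} {p : EGP I} (h : Compatible c w p) (e : I ≃ J) :
    Compatible c (w.relabel e) (p.relabel e) := by
  refine compatible_iff.2 fun x hx => ?_
  rw [EGP.relabel, face_relabelSet, relabelSet_nonempty]
  refine compatible_iff.1 h _ ?_
  rw [← w.relabel_relabel_symm e]
  exact comp_mem_chamber e.injective hx

lemma Compatible.prod {v : LinearOrd (I ⊕ J)} {p : EGP I} {q : EGP J}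
    (hp : Compatible c v.left p) (hq : Compatible c v.right q) : Compatible c v (p.prod q) := by
  refine compatible_iff.2 fun x hx => ?_
  rw [EGP.prod, face_prodSet, prodSet_nonempty]
  exact ⟨compatible_iff.1 hp _ (comp_mem_chamber Sum.inl_injective hx),
    compatible_iff.1 hq _ (comp_mem_chamber Sum.inr_injective hx)⟩

section

variable {v : LinearOrd (I ⊕ J)} {p : EGP (I ⊕ J)}

lemma Compatible.face_restrSet_contrSet_nonempty (h : Compatible c v p) (hp : p.BoundedLeft)
    {x : I ⊕ J → ℝ} (hx : x ∈ chamber c v) :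
    (face (restrSet p.1) (x ∘ Sum.inl)).Nonempty ∧
      (face (contrSet p.1) (x ∘ Sum.inr)).Nonempty := by
  obtain ⟨y, hy⟩ := compatible_iff.1 h x hx
  rw [← prodSet_nonempty, ← face_prodSet, ← p.2.face_eq_prodSet]
  exact face_nonempty_of_le (p.2.1.face _ hp) hp x (dot x y) fun z hz => hy.2 z hz.1

lemma Compatible.restr (h : Compatible c v p) (hv : v.LeftInitial) (hp : p.BoundedLeft) :
    Compatible c v.left (p.restr hp) := by
  refine compatible_iff.2 fun x hx => ?_
  obtain ⟨y, hy⟩ := chamber_nonempty c v.right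
  obtain ⟨C, hC⟩ := exists_elim_add_mem_chamber hv hx hy
  exact (h.face_restrSet_contrSet_nonempty hp hC).1

lemma Compatible.contr (h : Compatible c v p) (hv : v.LeftInitial) (hp : p.BoundedLeft) :
    Compatible c v.right (p.contr hp) := by
  refine compatible_iff.2 fun y hy => ?_
  obtain ⟨x, hx⟩ := chamber_nonempty c v.left
  obtain ⟨C, hC⟩ := exists_elim_add_mem_chamber hv hx hy
  have hbraid : y ∈ braidFace fun j => y j + C := fun i j => by rw [add_lt_add_iff_right]
  rw [(p.contr hp).2.face_eq_of_mem_braidFace hbraid]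
  exact (h.face_restrSet_contrSet_nonempty hp hC).2

end

theorem Compatible.exists_maxFace_eq_singleton {w : LinearOrd I} {p : EGP I}
    (h : Compatible c w p) :
    ∃ y ∈ Set.extremePoints ℝ p.1, maxFace p.1 (chamber c w) = {y} := by
  obtain ⟨x, hx⟩ := chamber_nonempty c w
  obtain ⟨y, hy⟩ := compatible_iff.1 h x hx
  rw [← maxFace_chamber p hx] at hy
  have hsingle : maxFace p.1 (chamber c w) = {y} := (maxFace_subsingleton p.1
    (isOpen_chamber c w) ⟨x, hx⟩).eq_singleton_of_mem hy
  refine ⟨y, isExtreme_singleton.1 ?_, hsingle⟩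
  rw [← hsingle, maxFace_chamber p hx]
  exact (isExposed_face p.1 x).isExtreme

end Compatible

section OGPplus

variable {k : Type v} [Field k]

lemma tensor_eq_tmul {I : Type u} [Finite I] (w : LinearOrd I) (p : EGP I) :
    tensor.{u, v} k w p = (Lstar.{u, v} k).tmul (GPplus k) I (Lstar.of k w) (GPplus.of k p) := rfl

lemma Compatible.tensor_mem {I : Type u} [Finite I] {c : ChamberConvention} {w : LinearOrd I}
    {p : EGP I} (h : Compatible c w p) :
    (Lstar.{u, v} k).tmul (GPplus k) I (Lstar.of k w) (GPplus.of k p) ∈ OGPplus k c I :=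
  Submodule.subset_span ⟨w, p, h, rfl⟩

lemma comul_tensor_mem {I J : Type u} [Finite I] [Finite J] {c : ChamberConvention}
    {v : LinearOrd (I ⊕ J)} {p : EGP (I ⊕ J)} (h : Compatible c v p) :
    ((Lstar k).hadamard (GPplus k)).comul I J (tensor k v p) ∈
      LinearMap.range (TensorProduct.mapIncl (OGPplus k c I) (OGPplus k c J)) := by
  rw [tensor_eq_tmul, hadamard_comul]
  by_cases hv : v.LeftInitial
  · by_cases hp : p.BoundedLeft
    · rw [Lstar.comul_of hv, GPplus.comul_of hp, TensorProduct.map₂_apply_tmul]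
      exact ⟨⟨_, (h.restr hv hp).tensor_mem⟩ ⊗ₜ ⟨_, (h.contr hv hp).tensor_mem⟩, rfl⟩
    · rw [GPplus.comul_of_eq_zero hp, map_zero]
      exact Submodule.zero_mem _
  · rw [Lstar.comul_of_eq_zero hv, map_zero, LinearMap.zero_apply]
    exact Submodule.zero_mem _

theorem isHopfSubmonoid_OGPplus (k : Type v) [Field k] (c : ChamberConvention) :
    IsHopfSubmonoid ((Lstar.{u, v} k).hadamard (GPplus.{u, v} k))
      (fun I [Finite I] => OGPplus k c I) := by
  refine isHopfSubmonoid_span (fun e => ?_) ?_ ?_ ?_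
  · rintro _ ⟨w, p, h, rfl⟩
    rw [tensor_eq_tmul, hadamard_map, Lstar.map_of, GPplus.map_of]
    exact (h.relabel e).tensor_mem
  · refine Compatible.tensor_mem (compatible_iff.2 fun x _ => ?_)
    rw [Subsingleton.elim x 0, face_zero]
    exact EGP.point.2.2.1
  · rintro I J _ _ _ ⟨w, p, hp, rfl⟩ _ ⟨t, q, hq, rfl⟩
    rw [tensor_eq_tmul, tensor_eq_tmul, hadamard_mul, Lstar.mul_of, GPplus.mul_of, Lstar.setSum,
      map_sum, LinearMap.sum_apply]
    refine Submodule.sum_mem _ fun v hv => Compatible.tensor_mem ?_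
    obtain ⟨rfl, rfl⟩ := (Set.Finite.mem_toFinset _).1 hv
    exact hp.prod hq
  · rintro I J _ _ _ ⟨v, p, h, rfl⟩
    exact comul_tensor_mem h

end OGPplus

end OrderedGP

end

theorem theorem3p3 (k : Type v) [Field k] :
    OrderedGP.IsHopfMonoid
        ((OrderedGP.Lstar.{u, v} k).hadamard (OrderedGP.GPplus.{u, v} k)) ∧
      ∀ c : OrderedGP.ChamberConvention,
        OrderedGP.IsHopfSubmonoid
            ((OrderedGP.Lstar.{u, v} k).hadamard (OrderedGP.GPplus.{u, v} k))
            (fun I [Finite I] => OrderedGP.OGPplus k c I) ∧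
          ∀ (I : Type u) [Finite I] (w : OrderedGP.LinearOrd I) (p : OrderedGP.EGP I),
            OrderedGP.Compatible c w p →
              ∃ x ∈ Set.extremePoints ℝ p.1,
                OrderedGP.maxFace p.1 (OrderedGP.chamber c w) = {x} :=
  ⟨(OrderedGP.isHopfMonoid_Lstar k).hadamard (OrderedGP.isHopfMonoid_GPplus k), fun c =>
    ⟨OrderedGP.isHopfSubmonoid_OGPplus k c, fun _ _ _ _ h => h.exists_maxFace_eq_singleton⟩⟩
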